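/- Let $d\in\mathbb N$, $d\ge 1$, and let $\Delta f(x)=\sum_{|y-x|=1}(f(x)-f(y))$ be the standard Laplacian on $\ell^2(\mathbb Z^d)$, a bounded nonnegative self-adjoint operator. For $\sigma\in(0,1]$ let $\Delta^\sigma$ be its power defined via the spectral theorem. For $\beta\in(-d/2,0)$ define the Riesz kernel $$\kappa_\beta(x)=\frac1{|\Gamma(-\beta)|}\int_0^\infty e^{-t\Delta}1_0(x)\,\frac{dt}{t^{1+\beta}},\qquad x\in\mathbb Z^d .$$ A function $w:\mathbb Z^d\to[0,\infty)$ is a Hardy weight (for $\Delta^\sigma$) if $\langle\Delta^\sigma\varphi,\varphi\rangle\ge\sum_{x\in\mathbb Z^d}w(x)\varphi(x)^2$ for all finitely supported $\varphi:\mathbb Z^d\to\mathbb R$. A Hardy weight $w$ is critical if every Hardy weight $w'\ge w$ equals $w$. Let $\mathcal D_0^\sigma$ be the space of functions on $\mathbb Z^d$ that is the closure of the finitely supported real functions with respect to the norm $(\langle\Delta^\sigma\varphi,\varphi\rangle+|\varphi(0)|^2)^{1/2}$ (that is, the pointwise limits of sequences that are Cauchy for this norm), and let $\mathcal Q^\sigma$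 be the continuous extension of $\varphi\mapsto\langle\Delta^\sigma\varphi,\varphi\rangle$ to $\mathcal D_0^\sigma$. A critical Hardy weight $w$ is positive critical if there is a $v\in\mathcal D_0^\sigma$, $v\ne0$, with $\mathcal Q^\sigma(v)=\sum_{x\in\mathbb Z^d}w(x)v(x)^2<\infty$. **Theorem.** Let $d\ge1$, $\sigma\in(0,1]$, with $\sigma<d/2$ if $d\in\{1,2\}$, let $\alpha\in(\sigma,d/2)$ and $\alpha_0=\frac{d/2+\sigma}{2}$. Then the weight $$w_{\sigma,\alpha}=\frac{\kappa_{\sigma-\alpha}}{\kappa_{-\alpha}}$$ is a positive critical Hardy weight if and only if $\alpha<\alpha_0$. -/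

import Mathlib

open Filter Topology

noncomputable section

namespace LatticeHardy

/-- The integer lattice `ℤ^d`. -/
abbrev Lattice (d : ℕ) : Type := Fin d → ℤ

/-- The complex Hilbert space `ℓ²(ℤ^d)`. -/
abbrev L2 (d : ℕ) : Type := lp (fun _ : Lattice d => ℂ) 2

/-- The translation `(shift z f)(x) = f(x + z)` as an isometry of `ℓ²(ℤ^d)`. -/
def shift {d : ℕ} (z : Lattice d) : L2 d →ₗᵢ[ℂ] L2 d where
  toFun f := ⟨fun x => f (x + z), by
    have h := (memℓp_gen_iff (p := 2) (by simp)).1 (lp.memℓp f)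
    exact memℓp_gen ((Equiv.addRight z).summable_iff.2 h)⟩
  map_add' _ _ := rfl
  map_smul' _ _ := rfl
  norm_map' f := by
    rw [lp.norm_eq_tsum_rpow (by simp), lp.norm_eq_tsum_rpow (by simp)]
    congr 1
    exact (Equiv.addRight z).tsum_eq (fun x => ‖f x‖ ^ (2 : ENNReal).toReal)

theorem shift_apply {d : ℕ} (z : Lattice d) (f : L2 d) (x : Lattice d) :
    shift z f x = f (x + z) := rfl

/-- The standard Laplacian `Δ f(x) = ∑_{|y - x| = 1} (f(x) - f(y))` as a bounded operator on
`ℓ²(ℤ^d)`. The neighbours of `x` are the `2d` points `x ± e_i`; see `laplacian_apply`. -/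
def laplacian (d : ℕ) : L2 d →L[ℂ] L2 d :=
  ∑ i : Fin d,
    ((1 - (shift (Pi.single i 1)).toContinuousLinearMap) +
      (1 - (shift (-Pi.single i 1)).toContinuousLinearMap))

theorem laplacian_apply (d : ℕ) (f : L2 d) (x : Lattice d) :
    laplacian d f x =
      ∑ i : Fin d, ((f x - f (x + Pi.single i 1)) + (f x - f (x - Pi.single i 1))) := by
  have h : ∀ g : Fin d → L2 d, (∑ i, g i : L2 d) x = ∑ i, g i x := fun g => by
    rw [lp.coeFn_sum, Finset.sum_apply]
  simp only [laplacian, sum_apply]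
  rw [h]
  simp [shift_apply, sub_eq_add_neg]

theorem inner_shift {d : ℕ} (z : Lattice d) (f g : L2 d) :
    inner ℂ (shift z f) g = inner ℂ f (shift (-z) g) := by
  rw [lp.inner_eq_tsum, lp.inner_eq_tsum,
    ← (Equiv.addRight z).tsum_eq (fun x => inner ℂ (f x) (shift (-z) g x))]
  simp [shift_apply]

/-- `Δ` is self-adjoint, so that its continuous functional calculus is available. -/
theorem isSelfAdjoint_laplacian (d : ℕ) : IsSelfAdjoint (laplacian d) := by
  rw [ContinuousLinearMap.isSelfAdjoint_iff_isSymmetric]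
  intro f g
  simp only [laplacian, ContinuousLinearMap.coe_coe, sum_apply,
    sum_inner, inner_sum]
  refine Finset.sum_congr rfl fun i _ => ?_
  simp [inner_add_left, inner_sub_left, inner_add_right, inner_sub_right, inner_shift]
  ring

/-- The heat semigroup `e^{-tΔ}` on `ℓ²(ℤ^d)`. -/
def heat (d : ℕ) (t : ℝ) : L2 d →L[ℂ] L2 d :=
  NormedSpace.exp ((-t) • laplacian d)

/-- The (real-valued) heat kernel `e^{-tΔ} 1_0 (x)`. -/
def heatKernel (d : ℕ) (t : ℝ) (x : Lattice d) : ℝ :=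
  (heat d t (lp.single 2 0 1) x).re

/-- The Riesz kernel `κ_α`, for `α ∈ (-d/2, 1]`. -/
def rieszKernel (d : ℕ) (α : ℝ) (x : Lattice d) : ℝ :=
  if α = 0 then (if x = 0 then 1 else 0)
  else if α = 1 then (if ∑ i, x i ^ 2 = 1 then 1 else 0)
  else if 0 < α ∧ x = 0 then 0
  else 1 / |Real.Gamma (-α)| * ∫ t in Set.Ioi (0 : ℝ), heatKernel d t x / t ^ (1 + α)

/-- The weight `w_{σ,α} = κ_{σ-α} / κ_{-α}`. -/
def hardyWeight (d : ℕ) (σ α : ℝ) (x : Lattice d) : ℝ :=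
  rieszKernel d (σ - α) x / rieszKernel d (-α) x

/-- The power `T^σ`, `σ > 0`, of a bounded nonnegative self-adjoint operator `T` on a complex
Hilbert space, through the spectral (continuous functional) calculus. -/
def spectralPower {H : Type*} [NormedAddCommGroup H] [InnerProductSpace ℂ H] [CompleteSpace H]
    (T : H →L[ℂ] H) (σ : ℝ) : H →L[ℂ] H :=
  cfc (fun s : ℝ => s ^ σ) T

/-- The fractional Laplacian `Δ^σ` on `ℓ²(ℤ^d)` for `σ > 0`. -/
def fracLaplacian (d : ℕ) (σ : ℝ) : L2 d →L[ℂ] L2 d :=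
  spectralPower (laplacian d) σ

/-- A finitely supported real function on `ℤ^d` (an element of `C_c(ℤ^d)`) as an element of
`ℓ²(ℤ^d)`. -/
def toL2 {d : ℕ} (φ : Lattice d →₀ ℝ) : L2 d :=
  ∑ x ∈ φ.support, lp.single 2 x (φ x : ℂ)

theorem toL2_apply {d : ℕ} (φ : Lattice d →₀ ℝ) (x : Lattice d) : toL2 φ x = (φ x : ℂ) := by
  rw [toL2, lp.coeFn_sum, Finset.sum_apply]
  simp only [lp.single_apply, Pi.single_apply]
  rw [Finset.sum_ite_eq]
  by_cases h : φ x = 0 <;> simp [h]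

/-- The quadratic form `⟨Δ^σ φ, φ⟩` on `C_c(ℤ^d)`. -/
def form {d : ℕ} (σ : ℝ) (φ : Lattice d →₀ ℝ) : ℝ :=
  (inner ℂ (fracLaplacian d σ (toL2 φ)) (toL2 φ)).re

/-- `w : ℤ^d → [0, ∞)` is a Hardy weight for `Δ^σ`. -/
def IsHardyWeight {d : ℕ} (σ : ℝ) (w : Lattice d → ℝ) : Prop :=
  (∀ x, 0 ≤ w x) ∧
    ∀ φ : Lattice d →₀ ℝ, ∑ x ∈ φ.support, w x * φ x ^ 2 ≤ form σ φ

/-- A Hardy weight is critical if no larger function is a Hardy weight. -/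
def IsCritical {d : ℕ} (σ : ℝ) (w : Lattice d → ℝ) : Prop :=
  IsHardyWeight σ w ∧
    ∀ w' : Lattice d → ℝ, IsHardyWeight σ w' → (∀ x, w x ≤ w' x) → w' = w

/-- `v` belongs to `D_0^σ`, the closure of `C_c(ℤ^d)` with respect to the norm
`(⟨Δ^σ φ, φ⟩ + |φ(0)|²)^{1/2}`, and `E` is the value at `v` of the continuous extension of
`φ ↦ ⟨Δ^σ φ, φ⟩` to `D_0^σ`: there is a sequence in `C_c(ℤ^d)` that is Cauchy for that norm,
converges to `v` pointwise, and along which the form tends to `E`. -/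
def HasEnergy {d : ℕ} (σ : ℝ) (v : Lattice d → ℝ) (E : ℝ) : Prop :=
  ∃ φ : ℕ → (Lattice d →₀ ℝ),
    (∀ ε > 0, ∃ N, ∀ m ≥ N, ∀ n ≥ N,
      Real.sqrt (form σ (φ m - φ n) + |(φ m - φ n) 0| ^ 2) < ε) ∧
    (∀ x, Tendsto (fun n => φ n x) atTop (𝓝 (v x))) ∧
    Tendsto (fun n => form σ (φ n)) atTop (𝓝 E)

/-- A critical Hardy weight `w` is positive critical if the Hardy inequality has a minimizer:
some `v ≠ 0` in `D_0^σ` whose energy equals `∑ w v²`. -/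
def IsPositiveCritical {d : ℕ} (σ : ℝ) (w : Lattice d → ℝ) : Prop :=
  IsCritical σ w ∧
    ∃ (v : Lattice d → ℝ) (E : ℝ), v ≠ 0 ∧ HasEnergy σ v E ∧ HasSum (fun x => w x * v x ^ 2) E

end LatticeHardy

end

/-! Put `u = κ_{-α}`, formally `Δ^{-α} 1_0`. Then `Δ^σ u = Δ^{σ-α} 1_0 = κ_{σ-α} = w u`, so `u` is a
positive ground state of `Δ^σ - w`. The off-diagonal matrix entries of `Δ^σ` are nonpositive, and
strictly negative between neighbours, so the ground state representation yields the Hardy inequality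
with a remainder that controls the variation of `φ / u` along any edge (`hardy_with_remainder`).

Formally, both `Q^σ(u)` and `∑ w u² = ∑ κ_{σ-α} κ_{-α}` equal `Δ^{-(2α-σ)} 1_0 (0)`, which by the
decay `t^{-d/2}` of the return probability is finite exactly when `2α - σ < d/2`, that is, `α <
α_0`. If it is finite, `u` lies in `D_0^σ` and is a minimizer (`hasEnergy_riesz`,
`hasSum_riesz_mul`); a strictly positive minimizer forces criticality, because every Hardy weight
`w' ≥ w` has `∑ w' u² ≤ Q^σ(u) = ∑ w u²`. Conversely, a minimizer makes the remainder vanish on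
every edge, so it is a multiple of `u` (`minimizer_eq_smul_riesz`), and `∑ w u²` must converge,
which fails for `α ≥ α_0` (`not_summable_riesz_mul`).

Negative powers of `Δ` are unbounded, so the identities are proved for `(Δ + ε)^{-β}` and carried
over as `ε → 0`. Only the heat kernel at the origin needs two-sided estimates; no spatial
asymptotics of the Riesz kernels enter. -/

noncomputable section

namespace LatticeHardy

open MeasureTheory Set
open scoped ComplexOrder

/-! ### Functional calculus and exponentials of bounded operators. -/

section FunctionalCalculus

variable {H : Type*} [NormedAddCommGroup H] [InnerProductSpace ℂ H] [CompleteSpace H]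

/-- The real continuous functional calculus of an operator on a complex Hilbert space. -/
def opFun (T : H →L[ℂ] H) (g : ℝ → ℝ) : H →L[ℂ] H := cfc g T

theorem spectrum_subset_Ici {T : H →L[ℂ] H} (hT : 0 ≤ T) : spectrum ℝ T ⊆ Ici 0 :=
  fun _ hs => spectrum_nonneg_of_nonneg hT hs

theorem opFun_exp {T : H →L[ℂ] H} (hT : IsSelfAdjoint T) (t : ℝ) :
    NormedSpace.exp (t • T) = opFun T (fun s => Real.exp (t * s)) := by
  have h1 : IsSelfAdjoint (t • T) := (IsSelfAdjoint.all t).smul hT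
  rw [← CFC.real_exp_eq_normedSpace_exp h1]
  have := cfc_comp_smul t Real.exp T (by fun_prop) hT
  simp only [smul_eq_mul] at this
  rw [opFun, this]

theorem opFun_symm (T : H →L[ℂ] H) (g : ℝ → ℝ) (f h : H) :
    inner ℂ (opFun T g f) h = inner ℂ f (opFun T g h) :=
  ContinuousLinearMap.isSelfAdjoint_iff_isSymmetric.1 (cfc_predicate g T) f h

theorem opFun_commute {T B : H →L[ℂ] H} (h : Commute T B) (g : ℝ → ℝ) :
    Commute (opFun T g) B := h.cfc_real g

theorem opFun_congr {T : H →L[ℂ] H} (hT : 0 ≤ T) {g h : ℝ → ℝ} (hgh : EqOn g h (Ici 0)) :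
    opFun T g = opFun T h := cfc_congr (hgh.mono (spectrum_subset_Ici hT))

theorem re_inner_opFun_mono {T : H →L[ℂ] H} (hT : 0 ≤ T) {g h : ℝ → ℝ}
    (hg : ContinuousOn g (Ici 0)) (hh : ContinuousOn h (Ici 0))
    (hgh : ∀ s, 0 ≤ s → g s ≤ h s) (f : H) :
    (inner ℂ (opFun T g f) f).re ≤ (inner ℂ (opFun T h f) f).re := by
  have hs := spectrum_subset_Ici hT
  have : opFun T g ≤ opFun T h :=
    cfc_mono (fun x hx => hgh x (hs hx)) (hg.mono hs) (hh.mono hs)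
  rw [ContinuousLinearMap.le_def] at this
  have h2 := this.re_inner_nonneg_left f
  simp only [sub_apply, inner_sub_left, map_sub] at h2
  exact sub_nonneg.1 h2

theorem opFun_mul {T : H →L[ℂ] H} (hT : 0 ≤ T) {g h : ℝ → ℝ}
    (hg : ContinuousOn g (Ici 0)) (hh : ContinuousOn h (Ici 0)) (f : H) :
    opFun T (fun s => g s * h s) f = opFun T g (opFun T h f) := by
  have hs := spectrum_subset_Ici hT
  have : opFun T (fun s => g s * h s) = opFun T g * opFun T h :=
    cfc_mul g h T (hg.mono hs) (hh.mono hs)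
  rw [this]; rfl

theorem opFun_sub {T : H →L[ℂ] H} (hT : 0 ≤ T) {g h : ℝ → ℝ}
    (hg : ContinuousOn g (Ici 0)) (hh : ContinuousOn h (Ici 0)) :
    opFun T (fun s => g s - h s) = opFun T g - opFun T h := by
  have hs := spectrum_subset_Ici hT
  exact cfc_sub g h T (hg.mono hs) (hh.mono hs)

theorem opFun_const_mul {T : H →L[ℂ] H} (hT : 0 ≤ T) (c : ℝ) {g : ℝ → ℝ}
    (hg : ContinuousOn g (Ici 0)) :
    opFun T (fun s => c * g s) = c • opFun T g :=
  cfc_const_mul c g T (hg.mono (spectrum_subset_Ici hT))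

theorem opFun_const {T : H →L[ℂ] H} (hT : 0 ≤ T) (c : ℝ) :
    opFun T (fun _ => c) = c • 1 := by
  have := cfc_const c T (IsSelfAdjoint.of_nonneg hT)
  rw [Algebra.algebraMap_eq_smul_one] at this
  exact this

theorem opFun_id {T : H →L[ℂ] H} (hT : 0 ≤ T) : opFun T (fun s => s) = T :=
  cfc_id' ℝ T (IsSelfAdjoint.of_nonneg hT)

/-- The functional `L` will be a matrix entry, which turns an integral representation of a scalar
function into a scalar integral for the entries of the operator. -/
theorem opFun_setIntegral {T : H →L[ℂ] H} (hT : 0 ≤ T) {μ : Measure ℝ} {s : Set ℝ}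
    (hs : MeasurableSet s) (f : ℝ → ℝ → ℝ) (bound : ℝ → ℝ)
    (hf : ContinuousOn (Function.uncurry f) (s ×ˢ spectrum ℝ T))
    (hb : ∀ t ∈ s, ∀ z ∈ spectrum ℝ T, |f t z| ≤ bound t)
    (hi : IntegrableOn bound s μ) (L : (H →L[ℂ] H) →L[ℂ] ℂ) :
    IntegrableOn (fun t => L (opFun T (f t))) s μ ∧
      L (opFun T fun z => ∫ t in s, f t z ∂μ) = ∫ t in s, L (opFun T (f t)) ∂μ := by
  have hsa := IsSelfAdjoint.of_nonneg hT
  have hb' : ∀ᵐ t ∂(μ.restrict s), ∀ z ∈ spectrum ℝ T, ‖f t z‖ ≤ bound t := by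
    filter_upwards [ae_restrict_mem hs] with t ht using hb t ht
  have h1 : IntegrableOn (fun t => cfc (f t) T) s μ :=
    integrableOn_cfc hs f bound T hf hb' hi.2 hsa
  have h2 : cfc (fun z => ∫ t in s, f t z ∂μ) T = ∫ t in s, cfc (f t) T ∂μ :=
    cfc_setIntegral hs f bound T hf hb' hi.2 hsa
  refine ⟨L.integrable_comp h1, ?_⟩
  rw [opFun, h2, ← L.integral_comp_comm h1]
  rfl

theorem exp_smul_one (c : ℝ) :
    NormedSpace.exp (c • (1 : H →L[ℂ] H)) = Real.exp c • 1 := by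
  have := NormedSpace.algebraMap_exp_comm (𝕂 := ℝ) (𝔸 := H →L[ℂ] H) c
  rw [Algebra.algebraMap_eq_smul_one, Algebra.algebraMap_eq_smul_one, ← Real.exp_eq_exp_ℝ] at this
  exact this.symm

theorem exp_add_of_commute' {A B : H →L[ℂ] H} (h : Commute A B) :
    NormedSpace.exp (A + B) = NormedSpace.exp A * NormedSpace.exp B := by
  let _ : NormedAlgebra ℚ (H →L[ℂ] H) := NormedAlgebra.restrictScalars ℚ ℝ _
  exact NormedSpace.exp_add_of_commute h

theorem exp_smul_one_add_smul (B : H →L[ℂ] H) (c t : ℝ) :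
    NormedSpace.exp (c • 1 + t • B) = Real.exp c • NormedSpace.exp (t • B) := by
  rw [exp_add_of_commute' ((Commute.one_left _).smul_left _), exp_smul_one, smul_mul_assoc,
    one_mul]

theorem continuous_exp_smul (B : H →L[ℂ] H) : Continuous fun t : ℝ => NormedSpace.exp (t • B) := by
  let _ : NormedAlgebra ℚ (H →L[ℂ] H) := NormedAlgebra.restrictScalars ℚ ℝ _
  exact NormedSpace.exp_continuous.comp (by fun_prop)

theorem hasSum_exp_smul (B : H →L[ℂ] H) (t : ℝ) (L : (H →L[ℂ] H) →L[ℂ] ℂ) :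
    HasSum (fun n : ℕ => ((t ^ n / n.factorial : ℝ) : ℂ) * L (B ^ n))
      (L (NormedSpace.exp (t • B))) := by
  have h := NormedSpace.exp_series_hasSum_exp' (𝕂 := ℂ) ((t : ℂ) • B)
  have h2 := L.hasSum h
  have h3 : (t : ℂ) • B = t • B := by ext; simp
  rw [← h3]
  refine h2.congr_fun fun n => ?_
  simp only [smul_pow, map_smul, smul_eq_mul]
  push_cast
  ring

end FunctionalCalculus

/-! ### Matrix entries, connectedness of the lattice, positivity of the Laplacian. -/

/-- The indicator function `1_x` in `ℓ²(ℤ^d)`. -/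
def delta {d : ℕ} (x : Lattice d) : L2 d := lp.single 2 x 1

theorem delta_apply {d : ℕ} (x y : Lattice d) : delta x y = if y = x then 1 else 0 := by
  simp [delta, lp.single_apply, Pi.single_apply]

theorem inner_delta_left {d : ℕ} (x : Lattice d) (f : L2 d) : inner ℂ (delta x) f = f x := by
  simp [delta, lp.inner_single_left]

theorem inner_delta_right {d : ℕ} (x : Lattice d) (f : L2 d) :
    inner ℂ f (delta x) = (starRingEnd ℂ) (f x) := by
  simp [delta, lp.inner_single_right]

theorem shift_delta {d : ℕ} (x z : Lattice d) : shift z (delta x) = delta (x - z) := by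
  ext y
  simp [shift_apply, delta_apply, eq_sub_iff_add_eq]

/-- Evaluation at a point as a continuous linear functional. -/
def evalAt {d : ℕ} (x : Lattice d) : L2 d →L[ℂ] ℂ := innerSL ℂ (delta x)

theorem evalAt_apply {d : ℕ} (x : Lattice d) (f : L2 d) : evalAt x f = f x := by
  simp [evalAt, inner_delta_left]

/-- The evaluation of an operator at a vector and a point, as a continuous linear functional. -/
def entryCLM {d : ℕ} (f : L2 d) (x : Lattice d) : (L2 d →L[ℂ] L2 d) →L[ℂ] ℂ :=
  (evalAt x).comp (ContinuousLinearMap.apply ℂ (L2 d) f)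

theorem entryCLM_apply {d : ℕ} (f : L2 d) (x : Lattice d) (B : L2 d →L[ℂ] L2 d) :
    entryCLM f x B = B f x := by
  simp [entryCLM, evalAt_apply]

/-- Connectedness of the nearest-neighbour graph; it serves both to spread positivity and to
propagate equality along edges. -/
theorem lattice_induction {d : ℕ} {P : Lattice d → Prop} (y : Lattice d) (hy : P y)
    (hp : ∀ x i, P x → P (x + Pi.single i 1)) (hm : ∀ x i, P x → P (x - Pi.single i 1))
    (x : Lattice d) : P x := by
  have h1 : ∀ (n : ℤ) (i : Fin d) (x : Lattice d), P x → P (x + Pi.single i n) := by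
    intro n i x hx
    induction n using Int.induction_on with
    | zero => simpa using hx
    | succ n ih =>
      have := hp _ i ih
      rwa [add_assoc, ← Pi.single_add] at this
    | pred n ih =>
      have := hm _ i ih
      rwa [add_sub_assoc, ← Pi.single_sub] at this
  have h2 : ∀ (z : Lattice d) (s : Finset (Fin d)), P (y + ∑ i ∈ s, Pi.single i (z i)) := by
    intro z s
    induction s using Finset.induction_on with
    | empty => simpa using hy
    | insert i s hi ih =>
      rw [Finset.sum_insert hi, add_left_comm, add_comm]
      exact h1 _ _ _ ih
  have := h2 (x - y) Finset.univ
  rw [Finset.univ_sum_single] at this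
  simpa using this

theorem inner_self_sub_shift {d : ℕ} (z : Lattice d) (f : L2 d) :
    inner ℂ ((f - shift z f) + (f - shift (-z) f)) f =
      inner ℂ (f - shift z f) (f - shift z f) := by
  have h : inner ℂ (shift z f) (shift z f) = inner ℂ f f := (shift z).inner_map_map f f
  have h2 : inner ℂ (shift (-z) f) f = inner ℂ f (shift z f) := by
    simpa using inner_shift (-z) f f
  simp only [inner_add_left, inner_sub_left, inner_sub_right, h, h2]
  ring

theorem laplacian_nonneg (d : ℕ) : 0 ≤ laplacian d := by
  rw [ContinuousLinearMap.nonneg_iff_isPositive, ContinuousLinearMap.isPositive_iff']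
  refine ⟨isSelfAdjoint_laplacian d, fun f => ?_⟩
  have : laplacian d f = ∑ i, ((f - shift (Pi.single i 1) f) + (f - shift (-Pi.single i 1) f)) := by
    simp [laplacian]
  rw [this, sum_inner]
  refine Finset.sum_nonneg fun i _ => ?_
  rw [inner_self_sub_shift, inner_self_eq_norm_sq_to_K]
  positivity

theorem heat_eq_opFun (d : ℕ) (t : ℝ) :
    heat d t = opFun (laplacian d) (fun s : ℝ => Real.exp (-t * s)) :=
  opFun_exp (isSelfAdjoint_laplacian d) (-t)

/-! ### Strict positivity of the heat semigroup. -/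

/-- The adjacency operator of `ℤ^d`. -/
def adjacency (d : ℕ) : L2 d →L[ℂ] L2 d :=
  ∑ i : Fin d, ((shift (Pi.single i 1)).toContinuousLinearMap +
    (shift (-Pi.single i 1)).toContinuousLinearMap)

theorem adjacency_apply (d : ℕ) (f : L2 d) (x : Lattice d) :
    adjacency d f x = ∑ i : Fin d, (f (x + Pi.single i 1) + f (x - Pi.single i 1)) := by
  have h : ∀ g : Fin d → L2 d, (∑ i, g i : L2 d) x = ∑ i, g i x := fun g => by
    rw [lp.coeFn_sum, Finset.sum_apply]
  simp only [adjacency, sum_apply]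
  rw [h]
  simp [shift_apply, sub_eq_add_neg]

theorem laplacian_eq (d : ℕ) : laplacian d = (2 * d : ℝ) • 1 - adjacency d := by
  ext f x
  simp only [sub_apply, lp.coeFn_sub, Pi.sub_apply, adjacency_apply,
    laplacian_apply]
  simp [Finset.sum_add_distrib]
  ring

theorem adjacency_nonneg {d : ℕ} {f : L2 d} (hf : ∀ x, 0 ≤ f x) (x : Lattice d) :
    0 ≤ adjacency d f x := by
  rw [adjacency_apply]
  exact Finset.sum_nonneg fun i _ => add_nonneg (hf _) (hf _)

theorem adjacency_pow_nonneg {d : ℕ} {f : L2 d} (hf : ∀ x, 0 ≤ f x) (n : ℕ) (x : Lattice d) :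
    0 ≤ (adjacency d ^ n) f x := by
  induction n generalizing x with
  | zero => simpa using hf x
  | succ n ih =>
    rw [pow_succ']
    exact adjacency_nonneg ih x

theorem adjacency_pos {d : ℕ} {f : L2 d} (hf : ∀ x, 0 ≤ f x) {x : Lattice d} (hx : 0 < f x)
    (i : Fin d) :
    0 < adjacency d f (x + Pi.single i 1) ∧ 0 < adjacency d f (x - Pi.single i 1) := by
  constructor
  all_goals
    rw [adjacency_apply]
    refine Finset.sum_pos' (fun i _ => add_nonneg (hf _) (hf _)) ⟨i, Finset.mem_univ _, ?_⟩
  · exact add_pos_of_nonneg_of_pos (hf _) (by simpa using hx)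
  · exact add_pos_of_pos_of_nonneg (by simpa using hx) (hf _)

theorem exists_adjacency_pow_pos {d : ℕ} {f : L2 d} (hf : ∀ x, 0 ≤ f x) {y : Lattice d}
    (hy : 0 < f y) (x : Lattice d) : ∃ n, 0 < (adjacency d ^ n) f x := by
  induction x using lattice_induction (y := y) with
  | hy => exact ⟨0, by simpa using hy⟩
  | hp x i hx =>
    obtain ⟨n, hn⟩ := hx
    refine ⟨n + 1, ?_⟩
    rw [pow_succ']
    exact (adjacency_pos (adjacency_pow_nonneg hf n) hn i).1
  | hm x i hx =>
    obtain ⟨n, hn⟩ := hx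
    refine ⟨n + 1, ?_⟩
    rw [pow_succ']
    exact (adjacency_pos (adjacency_pow_nonneg hf n) hn i).2

/-- The scalar `2d` commutes with everything, and what remains is the exponential of an entrywise
nonnegative operator, so positivity can be read off from its power series. Strict positivity at `x`
comes from the single term given by a lattice path to `x`. -/
theorem heat_eq_exp_adjacency (d : ℕ) (t : ℝ) :
    heat d t = Real.exp (-t * (2 * d)) • NormedSpace.exp (t • adjacency d) := by
  have h : (-t) • laplacian d = (-t * (2 * d)) • 1 + t • adjacency d := by
    rw [laplacian_eq, smul_sub, smul_smul]
    module
  rw [heat, h]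
  exact exp_smul_one_add_smul (adjacency d) _ t

theorem hasSum_exp_smul_apply {d : ℕ} (B : L2 d →L[ℂ] L2 d) (t : ℝ) (f : L2 d) (x : Lattice d) :
    HasSum (fun n : ℕ => ((t ^ n / n.factorial : ℝ) : ℂ) * (B ^ n) f x)
      (NormedSpace.exp (t • B) f x) := by
  have h := hasSum_exp_smul B t (entryCLM f x)
  simp only [entryCLM_apply] at h
  exact h

theorem heat_apply_nonneg {d : ℕ} {t : ℝ} (ht : 0 ≤ t) {f : L2 d} (hf : ∀ x, 0 ≤ f x)
    (x : Lattice d) : 0 ≤ heat d t f x := by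
  have h1 : 0 ≤ NormedSpace.exp (t • adjacency d) f x :=
    (hasSum_exp_smul_apply (adjacency d) t f x).nonneg fun n =>
      mul_nonneg (by rw [Complex.zero_le_real]; positivity) (adjacency_pow_nonneg hf n x)
  rw [heat_eq_exp_adjacency]
  simp only [smul_apply, lp.coeFn_smul, Pi.smul_apply, Complex.real_smul]
  exact mul_nonneg (by rw [Complex.zero_le_real]; positivity) h1

theorem heat_apply_pos {d : ℕ} {t : ℝ} (ht : 0 < t) {f : L2 d} (hf : ∀ x, 0 ≤ f x)
    {y : Lattice d} (hy : 0 < f y) (x : Lattice d) : 0 < heat d t f x := by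
  obtain ⟨n, hn⟩ := exists_adjacency_pow_pos hf hy x
  have h1 : 0 < NormedSpace.exp (t • adjacency d) f x := by
    refine lt_of_lt_of_le (mul_pos ?_ hn) (le_hasSum (hasSum_exp_smul_apply (adjacency d) t f x) n
      fun n _ => mul_nonneg (by rw [Complex.zero_le_real]; positivity)
        (adjacency_pow_nonneg hf n x))
    rw [Complex.zero_lt_real]
    positivity
  rw [heat_eq_exp_adjacency]
  simp only [smul_apply, lp.coeFn_smul, Pi.smul_apply, Complex.real_smul]
  exact mul_pos (by rw [Complex.zero_lt_real]; positivity) h1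

theorem delta_nonneg {d : ℕ} (y x : Lattice d) : 0 ≤ delta y x := by
  rw [delta_apply]; split_ifs <;> simp

/-- The matrix entries `(e^{-tΔ} 1_y)(x)` of the heat semigroup. -/
def heatEntry {d : ℕ} (t : ℝ) (y x : Lattice d) : ℝ := (heat d t (delta y) x).re

theorem heatEntry_zero {d : ℕ} (t : ℝ) (x : Lattice d) : heatEntry t 0 x = heatKernel d t x := rfl

theorem heatEntry_pos {d : ℕ} {t : ℝ} (ht : 0 < t) (y x : Lattice d) : 0 < heatEntry t y x :=
  (Complex.pos_iff.1 (heat_apply_pos ht (delta_nonneg y) (y := y) (by simp [delta_apply]) x)).1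

theorem heat_delta_apply {d : ℕ} {t : ℝ} (ht : 0 ≤ t) (y x : Lattice d) :
    heat d t (delta y) x = (heatEntry t y x : ℂ) :=
  Complex.eq_re_of_ofReal_le (r := 0) (by simpa using heat_apply_nonneg ht (delta_nonneg y) x)

theorem continuous_heatEntry {d : ℕ} (y x : Lattice d) :
    Continuous fun t => heatEntry t y x := by
  have : Continuous fun t : ℝ =>
      (entryCLM (delta y) x (NormedSpace.exp ((-t) • laplacian d))).re :=
    Complex.continuous_re.comp ((entryCLM (delta y) x).continuous.comp
      ((continuous_exp_smul (laplacian d)).comp continuous_neg))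
  simp only [entryCLM_apply] at this
  exact this

/-! ### Translation invariance and comparison of matrix entries. -/

theorem commute_laplacian_shift (d : ℕ) (z : Lattice d) :
    Commute (laplacian d) (shift z).toContinuousLinearMap := by
  refine ContinuousLinearMap.ext fun f => ?_
  ext x
  change laplacian d (shift z f) x = shift z (laplacian d f) x
  simp only [shift_apply, laplacian_apply]
  refine Finset.sum_congr rfl fun i _ => ?_
  rw [add_right_comm x, add_sub_right_comm]

theorem opFun_laplacian_shift (d : ℕ) (g : ℝ → ℝ) (z : Lattice d) (f : L2 d) :
    opFun (laplacian d) g (shift z f) = shift z (opFun (laplacian d) g f) :=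
  DFunLike.congr_fun (opFun_commute (commute_laplacian_shift d z) g).eq f

theorem opFun_diag (d : ℕ) (g : ℝ → ℝ) (x : Lattice d) :
    opFun (laplacian d) g (delta x) x = opFun (laplacian d) g (delta 0) 0 := by
  have h : delta x = shift (-x) (delta 0) := by simp [shift_delta]
  rw [h, opFun_laplacian_shift, shift_apply]
  simp

theorem opFun_entry_symm (d : ℕ) (g : ℝ → ℝ) (x y : Lattice d) :
    (opFun (laplacian d) g (delta x) y).re = (opFun (laplacian d) g (delta y) x).re := by
  have := congrArg Complex.re (opFun_symm (laplacian d) g (delta x) (delta y))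
  rwa [inner_delta_left, inner_delta_right, Complex.conj_re] at this

theorem opFun_entry_mono (d : ℕ) {g h : ℝ → ℝ} (hg : ContinuousOn g (Ici 0))
    (hh : ContinuousOn h (Ici 0)) (hgh : ∀ s, 0 ≤ s → g s ≤ h s) (x : Lattice d) :
    (opFun (laplacian d) g (delta x) x).re ≤ (opFun (laplacian d) h (delta x) x).re := by
  simpa [inner_delta_right] using re_inner_opFun_mono (laplacian_nonneg d) hg hh hgh (delta x)

/-- Test `g(Δ) ≥ 0` on `1_x - 1_y`: the diagonal entries agree by translation invariance and the
off-diagonal ones by symmetry. -/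
theorem opFun_entry_le_diag (d : ℕ) {g : ℝ → ℝ} (hg : ContinuousOn g (Ici 0))
    (hg0 : ∀ s, 0 ≤ s → 0 ≤ g s) (x y : Lattice d) :
    (opFun (laplacian d) g (delta y) x).re ≤ (opFun (laplacian d) g (delta 0) 0).re := by
  have h := re_inner_opFun_mono (laplacian_nonneg d) (g := fun _ => 0) continuousOn_const hg hg0
    (delta x - delta y)
  have h0 := opFun_diag d g x
  have h1 := opFun_diag d g y
  have h2 := opFun_entry_symm d g x y
  have h3 : opFun (laplacian d) (fun _ => 0) (delta x - delta y) = 0 := by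
    rw [opFun_const (laplacian_nonneg d)]
    exact zero_smul ℝ _
  simp only [h3, inner_zero_left, Complex.zero_re] at h
  simp only [map_sub, inner_sub_left, inner_sub_right, inner_delta_right, Complex.sub_re,
    Complex.conj_re, h0, h1, h2] at h
  linarith

theorem single_eq_smul_delta {d : ℕ} (y : Lattice d) (c : ℂ) :
    (lp.single 2 y c : L2 d) = c • delta y := by
  ext z
  simp [delta_apply, lp.single_apply, Pi.single_apply]

theorem hasSum_apply_delta {d : ℕ} (B : L2 d →L[ℂ] L2 d) (f : L2 d) (x : Lattice d) :
    HasSum (fun y => f y * B (delta y) x) (B f x) := by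
  have h := ((evalAt x).comp B).hasSum (lp.hasSum_single (p := 2) (by simp) f)
  simp only [ContinuousLinearMap.comp_apply, evalAt_apply] at h
  refine h.congr_fun fun y => ?_
  simp [single_eq_smul_delta]

/-! ### Fourier formula and the decay `t^{-d/2}` of the heat kernel at the origin. -/

/-- Lebesgue measure on the circle `(-π, π]`. -/
def circleMeasure : Measure ℝ := volume.restrict (Ioc (-Real.pi) Real.pi)

instance : IsFiniteMeasure circleMeasure := by
  unfold circleMeasure; infer_instance

/-- Lebesgue measure on the torus `(-π, π]^d`. -/
def torusMeasure (d : ℕ) : Measure (Fin d → ℝ) := Measure.pi fun _ => circleMeasure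

instance (d : ℕ) : IsFiniteMeasure (torusMeasure d) := by
  unfold torusMeasure; infer_instance

/-- The character `θ ↦ e^{i x·θ}`. -/
def torusChar {d : ℕ} (x : Lattice d) (θ : Fin d → ℝ) : ℂ :=
  ∏ j, Complex.exp (Complex.I * x j * θ j)

/-- The Fourier symbol `∑ (2 - 2 cos θ_j)` of the Laplacian. -/
def symbol {d : ℕ} (θ : Fin d → ℝ) : ℝ := ∑ j, (2 - 2 * Real.cos (θ j))

theorem continuous_torusChar {d : ℕ} (x : Lattice d) : Continuous (torusChar x) := by
  unfold torusChar; fun_prop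

theorem continuous_symbol {d : ℕ} : Continuous (symbol (d := d)) := by
  unfold symbol; fun_prop

theorem norm_torusChar {d : ℕ} (x : Lattice d) (θ : Fin d → ℝ) : ‖torusChar x θ‖ = 1 := by
  rw [torusChar, norm_prod]
  refine Finset.prod_eq_one fun j _ => ?_
  have : Complex.I * x j * θ j = ((x j * θ j : ℝ) : ℂ) * Complex.I := by push_cast; ring
  rw [this, Complex.norm_exp_ofReal_mul_I]

theorem symbol_nonneg {d : ℕ} (θ : Fin d → ℝ) : 0 ≤ symbol θ :=
  Finset.sum_nonneg fun j _ => by linarith [Real.cos_le_one (θ j)]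

theorem symbol_le {d : ℕ} (θ : Fin d → ℝ) : symbol θ ≤ 4 * d := by
  have : symbol θ ≤ ∑ _j : Fin d, (4 : ℝ) :=
    Finset.sum_le_sum fun j _ => by linarith [Real.neg_one_le_cos (θ j)]
  simpa [mul_comm] using this

theorem torusChar_add_single {d : ℕ} (x : Lattice d) (i : Fin d) (n : ℤ) (θ : Fin d → ℝ) :
    torusChar (x + Pi.single i n) θ = torusChar x θ * Complex.exp (Complex.I * n * θ i) := by
  have h : ∏ j, Complex.exp (Complex.I * (Pi.single i n : Lattice d) j * θ j) =
      Complex.exp (Complex.I * n * θ i) := by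
    rw [Finset.prod_eq_single i]
    · simp
    · intro j _ hj
      simp [Pi.single_eq_of_ne hj]
    · simp
  rw [← h, torusChar, torusChar, ← Finset.prod_mul_distrib]
  refine Finset.prod_congr rfl fun j _ => ?_
  rw [← Complex.exp_add]
  congr 1
  simp only [Pi.add_apply]
  push_cast
  ring

theorem symbol_mul_torusChar {d : ℕ} (x : Lattice d) (θ : Fin d → ℝ) :
    (symbol θ : ℂ) * torusChar x θ = ∑ i, ((torusChar x θ - torusChar (x + Pi.single i 1) θ) +
      (torusChar x θ - torusChar (x - Pi.single i 1) θ)) := by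
  have : ∀ i, x - Pi.single i 1 = x + Pi.single i (-1) := fun i => by
    rw [Pi.single_neg, sub_eq_add_neg]
  simp only [this, torusChar_add_single]
  rw [symbol]
  push_cast
  rw [Finset.sum_mul]
  refine Finset.sum_congr rfl fun i _ => ?_
  rw [Complex.cos]
  have h1 : Complex.I * 1 * (θ i : ℂ) = θ i * Complex.I := by ring
  have h2 : Complex.I * -1 * (θ i : ℂ) = -θ i * Complex.I := by ring
  rw [h1, h2]
  ring

theorem integral_exp_int_circle (n : ℤ) :
    ∫ θ, Complex.exp (Complex.I * n * θ) ∂circleMeasure = if n = 0 then 2 * Real.pi else 0 := by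
  have hpi : -Real.pi ≤ Real.pi := by linarith [Real.pi_pos]
  rw [circleMeasure, ← intervalIntegral.integral_of_le hpi]
  split_ifs with h
  · subst h
    simp
    ring
  · rw [integral_exp_mul_complex (by simp [h])]
    have : Complex.exp (Complex.I * n * Real.pi) = Complex.exp (Complex.I * n * (-Real.pi : ℝ)) := by
      rw [Complex.exp_eq_exp_iff_exists_int]
      exact ⟨n, by push_cast; ring⟩
    rw [this]
    simp

theorem integral_torusChar {d : ℕ} (x : Lattice d) :
    ∫ θ, torusChar x θ ∂(torusMeasure d) = if x = 0 then ((2 * Real.pi) ^ d : ℂ) else 0 := by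
  unfold torusChar torusMeasure
  rw [integral_fintype_prod_eq_prod (fun j (t : ℝ) => Complex.exp (Complex.I * x j * t))]
  simp only [integral_exp_int_circle]
  split_ifs with h
  · simp [h]
  · obtain ⟨j, hj⟩ := Function.ne_iff.1 h
    exact Finset.prod_eq_zero (Finset.mem_univ j) (by simpa using hj)

theorem integrable_symbol_pow_mul {d : ℕ} (n : ℕ) (x : Lattice d) :
    Integrable (fun θ => (symbol θ : ℂ) ^ n * torusChar x θ) (torusMeasure d) := by
  refine Integrable.of_bound (C := (4 * d) ^ n) ?_ ?_
  · exact (((Complex.continuous_ofReal.comp continuous_symbol).pow n).mul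
      (continuous_torusChar x)).aestronglyMeasurable
  · refine ae_of_all _ fun θ => ?_
    rw [norm_mul, norm_torusChar, mul_one, norm_pow, Complex.norm_real, Real.norm_eq_abs,
      abs_of_nonneg (symbol_nonneg θ)]
    exact pow_le_pow_left₀ (symbol_nonneg θ) (symbol_le θ) n

/-- Both sides satisfy the same recursion in `n`, since characters are eigenfunctions of `Δ`. This
replaces diagonalization of `Δ` by a unitary Fourier transform. -/
theorem laplacian_pow_apply {d : ℕ} (n : ℕ) (x : Lattice d) :
    ((2 * Real.pi) ^ d : ℂ) * (laplacian d ^ n) (delta 0) x =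
      ∫ θ, (symbol θ : ℂ) ^ n * torusChar x θ ∂(torusMeasure d) := by
  induction n generalizing x with
  | zero =>
    simp [integral_torusChar, delta_apply]
  | succ n ih =>
    have h : ∀ θ : Fin d → ℝ, (symbol θ : ℂ) ^ (n + 1) * torusChar x θ =
        ∑ i, (((symbol θ : ℂ) ^ n * torusChar x θ -
            (symbol θ : ℂ) ^ n * torusChar (x + Pi.single i 1) θ) +
          ((symbol θ : ℂ) ^ n * torusChar x θ -
            (symbol θ : ℂ) ^ n * torusChar (x - Pi.single i 1) θ)) := fun θ => by
      rw [pow_succ, mul_assoc, symbol_mul_torusChar, Finset.mul_sum]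
      exact Finset.sum_congr rfl fun i _ => by ring
    have hI := fun x => integrable_symbol_pow_mul (d := d) n x
    simp only [h]
    have hA : ∀ i : Fin d, Integrable (fun θ => ((symbol θ : ℂ) ^ n * torusChar x θ -
            (symbol θ : ℂ) ^ n * torusChar (x + Pi.single i 1) θ) +
          ((symbol θ : ℂ) ^ n * torusChar x θ -
            (symbol θ : ℂ) ^ n * torusChar (x - Pi.single i 1) θ)) (torusMeasure d) :=
      fun i => ((hI _).sub (hI _)).add ((hI _).sub (hI _))
    have hB : (laplacian d ^ (n + 1)) (delta 0) x =
        laplacian d ((laplacian d ^ n) (delta 0)) x := by rw [pow_succ']; rfl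
    rw [integral_finsetSum _ fun i _ => hA i, hB, laplacian_apply, Finset.mul_sum]
    refine Finset.sum_congr rfl fun i _ => ?_
    have hS : ∀ y, Integrable (fun θ => (symbol θ : ℂ) ^ n * torusChar x θ -
        (symbol θ : ℂ) ^ n * torusChar y θ) (torusMeasure d) := fun y => (hI _).sub (hI _)
    rw [integral_add (hS _) (hS _), integral_sub (hI _) (hI _),
      integral_sub (hI _) (hI _), ← ih, ← ih, ← ih]
    ring

theorem heatKernel_eq_integral (d : ℕ) {t : ℝ} (ht : 0 ≤ t) :
    (2 * Real.pi) ^ d * heatKernel d t 0 =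
      ∫ θ, Real.exp (-t * symbol θ) ∂(torusMeasure d) := by
  have h1 : HasSum (fun n : ℕ => ((((-t) ^ n / n.factorial : ℝ)) : ℂ) *
      (laplacian d ^ n) (delta 0) 0) (heat d t (delta 0) 0) :=
    hasSum_exp_smul_apply (laplacian d) (-t) (delta 0) 0
  have h2 := h1.mul_left ((2 * Real.pi) ^ d : ℂ)
  have h3 : HasSum (fun n : ℕ => ∫ θ, ((((-t) ^ n / n.factorial : ℝ)) : ℂ) *
      ((symbol θ : ℂ) ^ n * torusChar 0 θ) ∂(torusMeasure d))
      (∫ θ, ((Real.exp (-t * symbol θ) : ℝ) : ℂ) ∂(torusMeasure d)) := by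
    refine hasSum_integral_of_dominated_convergence
      (fun n _ => (t * (4 * d)) ^ n / n.factorial) (fun n => ?_) (fun n => ?_) ?_ ?_ ?_
    · exact ((integrable_symbol_pow_mul n 0).const_mul _).aestronglyMeasurable
    · refine ae_of_all _ fun θ => ?_
      rw [norm_mul, norm_mul, norm_torusChar, mul_one, norm_pow, Complex.norm_real,
        Complex.norm_real, Real.norm_eq_abs, Real.norm_eq_abs, abs_of_nonneg (symbol_nonneg θ),
        abs_div, abs_pow, abs_neg, abs_of_nonneg ht, Nat.abs_cast, mul_pow, div_mul_eq_mul_div]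
      gcongr
      · exact symbol_nonneg θ
      · exact symbol_le θ
    · exact ae_of_all _ fun θ => Real.summable_pow_div_factorial _
    · exact integrable_const _
    · refine ae_of_all _ fun θ => ?_
      have := NormedSpace.expSeries_div_hasSum_exp (𝔸 := ℂ) ((-t * symbol θ : ℝ) : ℂ)
      rw [← Complex.exp_eq_exp_ℂ, ← Complex.ofReal_exp] at this
      refine this.congr_fun fun n => ?_
      have hc : torusChar (0 : Lattice d) θ = 1 := by simp [torusChar]
      rw [hc]
      push_cast
      ring
  have h4 := h2.unique (h3.congr_fun fun n => ?_)
  · rw [heat_delta_apply ht, heatEntry_zero, integral_complex_ofReal] at h4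
    exact_mod_cast h4
  · rw [integral_const_mul, ← laplacian_pow_apply]
    ring

/-- The return probability of the one-dimensional heat kernel. -/
def returnProb (t : ℝ) : ℝ :=
  (2 * Real.pi)⁻¹ * ∫ θ, Real.exp (-t * (2 - 2 * Real.cos θ)) ∂circleMeasure

theorem heatKernel_zero_eq_pow (d : ℕ) {t : ℝ} (ht : 0 ≤ t) :
    heatKernel d t 0 = returnProb t ^ d := by
  have h := heatKernel_eq_integral d ht
  have h2 : ∀ θ : Fin d → ℝ, Real.exp (-t * symbol θ) =
      ∏ j, Real.exp (-t * (2 - 2 * Real.cos (θ j))) := fun θ => by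
    rw [symbol, Finset.mul_sum, Real.exp_sum]
  simp only [h2, torusMeasure] at h
  rw [integral_fintype_prod_eq_prod
    (fun (_ : Fin d) (s : ℝ) => Real.exp (-t * (2 - 2 * Real.cos s)))] at h
  rw [Finset.prod_const, Finset.card_univ, Fintype.card_fin] at h
  rw [returnProb, mul_pow, ← h, inv_pow, ← mul_assoc, inv_mul_cancel₀, one_mul]
  have := Real.pi_pos
  positivity

theorem integrableOn_exp_cos (t : ℝ) (s : Set ℝ) (hs : s ⊆ Ioc (-Real.pi) Real.pi) :
    IntegrableOn (fun θ => Real.exp (-t * (2 - 2 * Real.cos θ))) s := by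
  have : IntegrableOn (fun θ => Real.exp (-t * (2 - 2 * Real.cos θ))) (Icc (-Real.pi) Real.pi) :=
    (by fun_prop : Continuous _).continuousOn.integrableOn_compact isCompact_Icc
  exact this.mono_set (hs.trans Ioc_subset_Icc_self)

/-- On `[-π, π]` one has `cos θ ≤ 1 - 2θ²/π²`, which reduces the integral to a Gaussian. -/
theorem returnProb_le {t : ℝ} (ht : 0 < t) : returnProb t ≤ t ^ (-(1 / 2) : ℝ) * Real.pi := by
  have hpi := Real.pi_pos
  have hb : 0 < 4 * t / Real.pi ^ 2 := by positivity
  have h1 : ∫ θ in Ioc (-Real.pi) Real.pi, Real.exp (-t * (2 - 2 * Real.cos θ)) ≤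
      ∫ θ in Ioc (-Real.pi) Real.pi, Real.exp (-(4 * t / Real.pi ^ 2) * θ ^ 2) := by
    refine setIntegral_mono_on (integrableOn_exp_cos t _ subset_rfl)
      (integrable_exp_neg_mul_sq hb).integrableOn measurableSet_Ioc fun θ hθ => ?_
    rw [Real.exp_le_exp]
    have h2 := Real.cos_le_one_sub_mul_cos_sq (x := θ) (abs_le.2 ⟨hθ.1.le, hθ.2⟩)
    have h3 : 4 * t / Real.pi ^ 2 * θ ^ 2 = 2 * t * (2 / Real.pi ^ 2 * θ ^ 2) := by ring
    nlinarith
  have h2 : ∫ θ in Ioc (-Real.pi) Real.pi, Real.exp (-(4 * t / Real.pi ^ 2) * θ ^ 2) ≤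
      ∫ θ, Real.exp (-(4 * t / Real.pi ^ 2) * θ ^ 2) :=
    setIntegral_le_integral (integrable_exp_neg_mul_sq hb) (ae_of_all _ fun θ => by positivity)
  rw [integral_gaussian] at h2
  -- The crude constant `2π²` is chosen so that the normalization `(2π)⁻¹` leaves `π`.
  have h3 : √(Real.pi / (4 * t / Real.pi ^ 2)) ≤ t ^ (-(1 / 2) : ℝ) * (2 * Real.pi ^ 2) := by
    rw [Real.rpow_neg ht.le, ← Real.sqrt_eq_rpow]
    refine Real.sqrt_le_iff.2 ⟨by positivity, ?_⟩
    rw [mul_pow, inv_pow, Real.sq_sqrt ht.le]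
    have : Real.pi / (4 * t / Real.pi ^ 2) = t⁻¹ * (Real.pi ^ 3 / 4) := by field_simp
    rw [this]
    refine mul_le_mul_of_nonneg_left ?_ (by positivity)
    have : 1 ≤ Real.pi := by linarith [Real.pi_gt_three]
    have h4 : Real.pi ^ 3 ≤ Real.pi ^ 4 := pow_le_pow_right₀ this (by norm_num)
    nlinarith [pow_pos hpi 4]
  have h4 := (h1.trans h2).trans h3
  rw [returnProb, circleMeasure, inv_mul_le_iff₀ (by positivity)]
  linarith [h4]

/-- For `0 < θ ≤ t^{-1/2}` the exponent is at least `-tθ² ≥ -1`; only this part of the circle is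
kept. -/
theorem le_returnProb {t : ℝ} (ht : 1 ≤ t) :
    t ^ (-(1 / 2) : ℝ) * ((2 * Real.pi)⁻¹ * Real.exp (-1)) ≤ returnProb t := by
  have hpi := Real.pi_gt_three
  have ht0 : 0 < t := by linarith
  set r := t ^ (-(1 / 2) : ℝ) with hr
  have hr0 : 0 < r := Real.rpow_pos_of_pos ht0 _
  have hr1 : r ≤ 1 := Real.rpow_le_one_of_one_le_of_nonpos ht (by norm_num)
  have hr2 : t * r ^ 2 = 1 := by
    rw [hr, ← Real.rpow_natCast, ← Real.rpow_mul ht0.le]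
    norm_num
    rw [Real.rpow_neg_one]
    exact mul_inv_cancel₀ ht0.ne'
  have hsub : Ioc 0 r ⊆ Ioc (-Real.pi) Real.pi :=
    Ioc_subset_Ioc (by linarith) (by linarith)
  have h1 : ∫ θ in Ioc 0 r, Real.exp (-t * (2 - 2 * Real.cos θ)) ≤
      ∫ θ in Ioc (-Real.pi) Real.pi, Real.exp (-t * (2 - 2 * Real.cos θ)) :=
    setIntegral_mono_set (integrableOn_exp_cos t _ subset_rfl)
      (ae_of_all _ fun θ => by positivity) hsub.eventuallyLE
  have h2 : ∫ _θ in Ioc 0 r, Real.exp (-1) ≤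
      ∫ θ in Ioc 0 r, Real.exp (-t * (2 - 2 * Real.cos θ)) := by
    refine setIntegral_mono_on (integrableOn_const (by simp)) (integrableOn_exp_cos t _ hsub)
      measurableSet_Ioc fun θ hθ => ?_
    rw [Real.exp_le_exp]
    have h3 := Real.one_sub_sq_div_two_le_cos (x := θ)
    have h4 : θ ^ 2 ≤ r ^ 2 := pow_le_pow_left₀ hθ.1.le hθ.2 2
    nlinarith
  have h3 : ∫ _θ in Ioc 0 r, Real.exp (-1) = r * Real.exp (-1) := by
    simp [hr0.le]
  rw [returnProb, circleMeasure]
  calc r * ((2 * Real.pi)⁻¹ * Real.exp (-1)) = (2 * Real.pi)⁻¹ * (r * Real.exp (-1)) := by ring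
    _ ≤ _ := mul_le_mul_of_nonneg_left (h3 ▸ h2.trans h1) (by positivity)

theorem returnProb_nonneg (t : ℝ) : 0 ≤ returnProb t :=
  mul_nonneg (by have := Real.pi_pos; positivity)
    (integral_nonneg fun _ => (Real.exp_pos _).le)

theorem rpow_neg_half_pow {t : ℝ} (ht : 0 < t) (d : ℕ) :
    (t ^ (-(1 / 2) : ℝ)) ^ d = t ^ (-(d / 2 : ℝ)) := by
  rw [← Real.rpow_natCast, ← Real.rpow_mul ht.le]
  congr 1
  ring

theorem heatKernel_zero_le (d : ℕ) {t : ℝ} (ht : 0 < t) :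
    heatKernel d t 0 ≤ Real.pi ^ d * t ^ (-(d / 2 : ℝ)) := by
  rw [heatKernel_zero_eq_pow d ht.le, ← rpow_neg_half_pow ht, mul_comm, ← mul_pow]
  exact pow_le_pow_left₀ (returnProb_nonneg t) (returnProb_le ht) d

theorem exists_le_heatKernel_zero (d : ℕ) :
    ∃ c > 0, ∀ t, 1 ≤ t → c * t ^ (-(d / 2 : ℝ)) ≤ heatKernel d t 0 := by
  have := Real.pi_pos
  refine ⟨((2 * Real.pi)⁻¹ * Real.exp (-1)) ^ d, by positivity, fun t ht => ?_⟩
  have ht0 : 0 < t := by linarith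
  rw [heatKernel_zero_eq_pow d ht0.le, ← rpow_neg_half_pow ht0, mul_comm, ← mul_pow]
  refine pow_le_pow_left₀ (by positivity) (le_returnProb ht) d

theorem heatEntry_le_one {d : ℕ} {t : ℝ} (ht : 0 ≤ t) (y x : Lattice d) :
    heatEntry t y x ≤ 1 := by
  have hc : ContinuousOn (fun s : ℝ => Real.exp (-t * s)) (Ici 0) := by fun_prop
  have h1 := opFun_entry_le_diag d hc (fun s _ => (Real.exp_pos _).le) x y
  have h2 := opFun_entry_mono d hc (continuousOn_const (c := (1 : ℝ)))
    (fun s hs => Real.exp_le_one_iff.2 (by nlinarith)) 0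
  have h3 : (opFun (laplacian d) (fun _ => 1) (delta 0) 0).re = 1 := by
    rw [opFun_const (laplacian_nonneg d)]
    change ((1 : ℝ) • delta (d := d) 0 0).re = 1
    rw [one_smul]
    simp [delta_apply]
  rw [heatEntry, heat_eq_opFun]
  linarith

theorem heatKernel_le_zero (d : ℕ) (t : ℝ) (x : Lattice d) :
    heatKernel d t x ≤ heatKernel d t 0 := by
  rw [← heatEntry_zero, ← heatEntry_zero, heatEntry, heatEntry, heat_eq_opFun]
  exact opFun_entry_le_diag d (by fun_prop) (fun s _ => (Real.exp_pos _).le) x 0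

theorem heatKernel_pos {d : ℕ} {t : ℝ} (ht : 0 < t) (x : Lattice d) : 0 < heatKernel d t x :=
  heatEntry_pos ht 0 x

theorem continuous_heatKernel {d : ℕ} (x : Lattice d) : Continuous fun t => heatKernel d t x :=
  continuous_heatEntry 0 x

/-! ### The regularized kernels of `(Δ + ε)^{-β}`. -/

theorem continuousOn_add_rpow {ε : ℝ} (hε : 0 < ε) (p : ℝ) :
    ContinuousOn (fun s : ℝ => (s + ε) ^ p) (Ici 0) :=
  ContinuousOn.rpow_const (by fun_prop) fun s hs => Or.inl (by
    have : 0 ≤ s := hs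
    positivity)

/-- The matrix entries of `(Δ + ε)^{-β}`. -/
def greenEntry {d : ℕ} (ε β : ℝ) (y x : Lattice d) : ℝ :=
  (opFun (laplacian d) (fun s => (s + ε) ^ (-β)) (delta y) x).re

theorem integrableOn_rpow_mul_exp {ε β : ℝ} (hε : 0 < ε) (hβ : 0 < β) :
    IntegrableOn (fun t : ℝ => t ^ (β - 1) * Real.exp (-ε * t)) (Ioi 0) := by
  have := integrableOn_rpow_mul_exp_neg_mul_rpow (p := 1) (s := β - 1) (b := ε) (by linarith)
    one_pos hε
  simpa using this

/-- The Gamma integral for `(s + ε)^{-β}`, applied to `s = Δ`. The factor `e^{-εt}` makes it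
converge in operator norm for every `β > 0`. -/
theorem green_representation {d : ℕ} {ε β : ℝ} (hε : 0 < ε) (hβ : 0 < β) (y x : Lattice d) :
    IntegrableOn (fun t => t ^ (β - 1) * Real.exp (-ε * t) * heatEntry t y x) (Ioi 0) ∧
    opFun (laplacian d) (fun s => (s + ε) ^ (-β)) (delta y) x =
      (((Real.Gamma β)⁻¹ * ∫ t in Ioi 0, t ^ (β - 1) * Real.exp (-ε * t) * heatEntry t y x : ℝ) :
        ℂ) := by
  have hΓ := Real.Gamma_pos_of_pos hβ
  have hT := laplacian_nonneg d
  have hspec := spectrum_subset_Ici hT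
  obtain ⟨h1, h2⟩ := opFun_setIntegral hT (μ := volume) (s := Ioi 0) measurableSet_Ioi
    (fun t s => t ^ (β - 1) * Real.exp (-ε * t) * Real.exp (-t * s))
    (fun t => t ^ (β - 1) * Real.exp (-ε * t)) (by
      refine ContinuousOn.mul (ContinuousOn.mul ?_ (by fun_prop)) (by fun_prop)
      exact ContinuousOn.rpow_const (by fun_prop) fun p hp => Or.inl (ne_of_gt hp.1)) (by
      intro t ht z hz
      have ht' : 0 < t := ht
      have hz' : 0 ≤ z := hspec hz
      rw [abs_of_nonneg (by positivity)]
      refine mul_le_of_le_one_right (by positivity) (Real.exp_le_one_iff.2 ?_)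
      nlinarith) (integrableOn_rpow_mul_exp hε hβ) (entryCLM (delta y) x)
  have h3 : ∀ t ∈ Ioi (0 : ℝ), entryCLM (delta y) x (opFun (laplacian d)
      (fun s => t ^ (β - 1) * Real.exp (-ε * t) * Real.exp (-t * s))) =
      ((t ^ (β - 1) * Real.exp (-ε * t) * heatEntry t y x : ℝ) : ℂ) := fun t ht => by
    rw [opFun_const_mul hT _ (by fun_prop), ← heat_eq_opFun, entryCLM_apply]
    have := heat_delta_apply (le_of_lt ht) y x
    rw [Complex.ofReal_mul, ← this]
    exact Complex.real_smul
  have h4 : opFun (laplacian d) (fun s => ∫ t in Ioi 0,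
      t ^ (β - 1) * Real.exp (-ε * t) * Real.exp (-t * s)) =
      Real.Gamma β • opFun (laplacian d) (fun s => (s + ε) ^ (-β)) := by
    refine Eq.trans (opFun_congr hT fun s hs => ?_)
      (opFun_const_mul hT _ (continuousOn_add_rpow hε _))
    have hs' : 0 ≤ s := hs
    have hpos : 0 < s + ε := by linarith
    have := Real.integral_rpow_mul_exp_neg_mul_Ioi hβ hpos
    rw [one_div, Real.inv_rpow hpos.le, ← Real.rpow_neg hpos.le] at this
    rw [mul_comm, ← this]
    refine integral_congr_ae (ae_of_all _ fun t => ?_)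
    simp only
    rw [mul_assoc, ← Real.exp_add]
    congr 2
    ring
  rw [integrableOn_congr_fun h3 measurableSet_Ioi] at h1
  rw [setIntegral_congr_fun measurableSet_Ioi h3, integral_complex_ofReal, h4, entryCLM_apply] at h2
  have h5 := h1.re
  simp only [RCLike.re_to_complex, Complex.ofReal_re] at h5
  refine ⟨h5, ?_⟩
  rw [Complex.ofReal_mul, ← h2]
  have : (((Real.Gamma β • opFun (laplacian d) (fun s => (s + ε) ^ (-β))) (delta y) : L2 d) x) =
      (Real.Gamma β : ℂ) * opFun (laplacian d) (fun s => (s + ε) ^ (-β)) (delta y) x :=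
    Complex.real_smul
  rw [this, ← mul_assoc, ← Complex.ofReal_mul, inv_mul_cancel₀ hΓ.ne']
  simp

theorem greenEntry_eq {d : ℕ} {ε β : ℝ} (hε : 0 < ε) (hβ : 0 < β) (y x : Lattice d) :
    greenEntry ε β y x =
      (Real.Gamma β)⁻¹ * ∫ t in Ioi 0, t ^ (β - 1) * Real.exp (-ε * t) * heatEntry t y x := by
  rw [greenEntry, (green_representation hε hβ y x).2, Complex.ofReal_re]

theorem green_apply {d : ℕ} {ε β : ℝ} (hε : 0 < ε) (hβ : 0 < β) (y x : Lattice d) :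
    opFun (laplacian d) (fun s => (s + ε) ^ (-β)) (delta y) x = (greenEntry ε β y x : ℂ) := by
  rw [greenEntry, (green_representation hε hβ y x).2, Complex.ofReal_re]

theorem greenEntry_pos {d : ℕ} {ε β : ℝ} (hε : 0 < ε) (hβ : 0 < β) (y x : Lattice d) :
    0 < greenEntry ε β y x := by
  rw [greenEntry_eq hε hβ]
  refine mul_pos (inv_pos.2 (Real.Gamma_pos_of_pos hβ)) ?_
  have hpos : ∀ t ∈ Ioi (0 : ℝ), 0 < t ^ (β - 1) * Real.exp (-ε * t) * heatEntry t y x :=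
    fun t ht => mul_pos (mul_pos (Real.rpow_pos_of_pos ht _) (Real.exp_pos _)) (heatEntry_pos ht y x)
  rw [setIntegral_pos_iff_support_of_nonneg_ae
    ((ae_restrict_mem measurableSet_Ioi).mono fun t ht => (hpos t ht).le)
    (green_representation hε hβ y x).1]
  have : (Function.support fun t => t ^ (β - 1) * Real.exp (-ε * t) * heatEntry t y x) ∩ Ioi 0 =
      Ioi 0 := inter_eq_right.2 fun t ht => (hpos t ht).ne'
  rw [this]
  simp

/-- The sum is the inner product of two `ℓ²` vectors; symmetry moves one operator across and the
exponents add. -/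
theorem hasSum_green_mul {d : ℕ} {ε β γ : ℝ} (hε : 0 < ε) (hβ : 0 < β) (hγ : 0 < γ) :
    HasSum (fun x : Lattice d => greenEntry ε β 0 x * greenEntry ε γ 0 x)
      (greenEntry ε (β + γ) (0 : Lattice d) 0) := by
  have hT := laplacian_nonneg d
  have h := lp.hasSum_inner (𝕜 := ℂ)
    (opFun (laplacian d) (fun s => (s + ε) ^ (-β)) (delta (0 : Lattice d)))
    (opFun (laplacian d) (fun s => (s + ε) ^ (-γ)) (delta (0 : Lattice d)))
  rw [opFun_symm, inner_delta_left, ← opFun_mul hT (continuousOn_add_rpow hε _)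
    (continuousOn_add_rpow hε _)] at h
  have h2 : opFun (laplacian d) (fun s => (s + ε) ^ (-β) * (s + ε) ^ (-γ)) =
      opFun (laplacian d) (fun s => (s + ε) ^ (-(β + γ))) :=
    opFun_congr hT fun s hs => by
      have hs' : 0 ≤ s := hs
      have hpos : 0 < s + ε := by linarith
      rw [← Real.rpow_add hpos]
      congr 1
      ring
  rw [h2, green_apply hε (add_pos hβ hγ)] at h
  refine Complex.hasSum_ofReal.1 (h.congr_fun fun x => ?_)
  rw [green_apply hε hβ, green_apply hε hγ]
  simp [mul_comm]

/-! ### Riesz kernels as limits, and the sums of their products. -/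

/-- The Riesz kernel `Δ^{-β} 1_0`, `0 < β < d/2`. -/
def riesz {d : ℕ} (β : ℝ) (x : Lattice d) : ℝ :=
  (Real.Gamma β)⁻¹ * ∫ t in Ioi 0, t ^ (β - 1) * heatKernel d t x

theorem rieszKernel_neg {d : ℕ} {β : ℝ} (hβ : 0 < β) (x : Lattice d) :
    rieszKernel d (-β) x = riesz β x := by
  rw [rieszKernel, if_neg (by linarith), if_neg (by linarith), if_neg (by
    rintro ⟨h, -⟩
    linarith), neg_neg, abs_of_pos (Real.Gamma_pos_of_pos hβ), one_div, riesz]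
  congr 1
  refine setIntegral_congr_fun measurableSet_Ioi fun t ht => ?_
  have ht' : 0 < t := ht
  rw [div_eq_mul_inv, ← Real.rpow_neg ht'.le, mul_comm]
  congr 2
  ring

/-- Near `0` the heat kernel is at most `1` and `β > 0` suffices; near infinity its decay `t^{-d/2}`
requires `β < d/2`. -/
theorem integrableOn_riesz {d : ℕ} {β : ℝ} (hβ : 0 < β) (hβd : β < d / 2) (x : Lattice d) :
    IntegrableOn (fun t => t ^ (β - 1) * heatKernel d t x) (Ioi 0) := by
  have hm : ∀ s : Set ℝ, MeasurableSet s → s ⊆ Ioi 0 → AEStronglyMeasurable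
      (fun t => t ^ (β - 1) * heatKernel d t x) (volume.restrict s) := fun s hs hs0 =>
    ContinuousOn.aestronglyMeasurable ((ContinuousOn.rpow_const (by fun_prop) fun p hp =>
      Or.inl (ne_of_gt (hs0 hp))).mul (continuous_heatKernel x).continuousOn) hs
  rw [← Ioc_union_Ioi_eq_Ioi (zero_le_one' ℝ)]
  refine IntegrableOn.union ?_ ?_
  · have h1 : IntegrableOn (fun t : ℝ => t ^ (β - 1)) (Ioc 0 1) := by
      rw [← intervalIntegrable_iff_integrableOn_Ioc_of_le zero_le_one]
      exact intervalIntegral.intervalIntegrable_rpow' (by linarith)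
    refine Integrable.mono' h1 (hm _ measurableSet_Ioc fun t ht => ht.1) ?_
    filter_upwards [ae_restrict_mem measurableSet_Ioc] with t ht
    have ht0 : 0 < t := ht.1
    have hp := heatKernel_pos ht0 x
    rw [Real.norm_of_nonneg (by positivity)]
    exact mul_le_of_le_one_right (by positivity) (heatEntry_le_one ht0.le 0 x)
  · have h1 : IntegrableOn (fun t : ℝ => Real.pi ^ d * t ^ (β - 1 - d / 2)) (Ioi 1) :=
      (integrableOn_Ioi_rpow_of_lt (by linarith) one_pos).const_mul _
    refine Integrable.mono' h1 (hm _ measurableSet_Ioi fun t ht => (one_pos.trans ht : (0 : ℝ) < t)) ?_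
    filter_upwards [ae_restrict_mem measurableSet_Ioi] with t ht
    have ht0 : 0 < t := one_pos.trans ht
    have hp := heatKernel_pos ht0 x
    rw [Real.norm_of_nonneg (by positivity), sub_eq_add_neg (β - 1), Real.rpow_add ht0,
      mul_left_comm]
    exact mul_le_mul_of_nonneg_left ((heatKernel_le_zero d t x).trans (heatKernel_zero_le d ht0))
      (by positivity)

theorem green_le_riesz {d : ℕ} {ε β : ℝ} (hε : 0 < ε) (hβ : 0 < β) (hβd : β < d / 2)
    (x : Lattice d) : greenEntry ε β 0 x ≤ riesz β x := by
  rw [greenEntry_eq hε hβ, riesz]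
  refine mul_le_mul_of_nonneg_left ?_ (inv_nonneg.2 (Real.Gamma_pos_of_pos hβ).le)
  refine setIntegral_mono_on (green_representation hε hβ 0 x).1 (integrableOn_riesz hβ hβd x)
    measurableSet_Ioi fun t ht => ?_
  have ht0 : 0 < t := ht
  have hp := heatKernel_pos ht0 x
  rw [heatEntry_zero, mul_right_comm]
  exact mul_le_of_le_one_right (by positivity) (Real.exp_le_one_iff.2 (by nlinarith))

theorem riesz_pos {d : ℕ} {β : ℝ} (hβ : 0 < β) (hβd : β < d / 2) (x : Lattice d) :
    0 < riesz β x :=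
  (greenEntry_pos one_pos hβ 0 x).trans_le (green_le_riesz one_pos hβ hβd x)

theorem tendsto_green {d : ℕ} {β : ℝ} (hβ : 0 < β) (hβd : β < d / 2) (x : Lattice d) :
    Tendsto (fun ε => greenEntry ε β 0 x) (𝓝[>] 0) (𝓝 (riesz β x)) := by
  have h : Tendsto (fun ε : ℝ => (Real.Gamma β)⁻¹ *
      ∫ t in Ioi 0, t ^ (β - 1) * Real.exp (-ε * t) * heatEntry t 0 x) (𝓝[>] 0)
      (𝓝 (riesz β x)) := by
    refine Tendsto.const_mul _ ?_
    refine tendsto_integral_filter_of_dominated_convergence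
      (fun t => t ^ (β - 1) * heatKernel d t x) ?_ ?_ (integrableOn_riesz hβ hβd x) ?_
    · filter_upwards [self_mem_nhdsWithin] with ε hε
      exact (green_representation hε hβ 0 x).1.aestronglyMeasurable
    · filter_upwards [self_mem_nhdsWithin] with ε hε
      have hε' : 0 < ε := hε
      filter_upwards [ae_restrict_mem measurableSet_Ioi] with t ht
      have ht0 : 0 < t := ht
      have hp := heatKernel_pos ht0 x
      rw [heatEntry_zero, Real.norm_of_nonneg (by positivity), mul_right_comm]
      exact mul_le_of_le_one_right (by positivity) (Real.exp_le_one_iff.2 (by nlinarith))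
    · refine ae_of_all _ fun t => ?_
      have : Tendsto (fun ε : ℝ => t ^ (β - 1) * Real.exp (-ε * t) * heatEntry t 0 x) (𝓝 0)
          (𝓝 (t ^ (β - 1) * Real.exp (-0 * t) * heatEntry t 0 x)) :=
        Continuous.tendsto (by fun_prop) 0
      simp only [neg_zero, zero_mul, Real.exp_zero, mul_one] at this
      exact this.mono_left nhdsWithin_le_nhds
  refine h.congr' ?_
  filter_upwards [self_mem_nhdsWithin] with ε hε
  exact (greenEntry_eq hε hβ 0 x).symm

/-- Take `ε = 1/R`: on `(1, R]` the factor `e^{-εt}` is at least `e^{-1}` and the rest of the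
integrand is at least a multiple of `1/t`, so the entry grows at least like `log R`. -/
theorem green_zero_unbounded {d : ℕ} {β : ℝ} (hβ : 0 < β) (hβd : (d : ℝ) / 2 ≤ β) (M : ℝ) :
    ∃ ε > 0, M < greenEntry ε β (0 : Lattice d) 0 := by
  obtain ⟨c, hc, hcb⟩ := exists_le_heatKernel_zero d
  have hΓ := Real.Gamma_pos_of_pos hβ
  set K := (Real.Gamma β)⁻¹ * (c * Real.exp (-1)) with hK
  have hK0 : 0 < K := by positivity
  obtain ⟨R, hR1, hRM⟩ : ∃ R : ℝ, 1 < R ∧ M < K * Real.log R := by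
    have h1 : Tendsto (fun R => K * Real.log R) atTop atTop :=
      Real.tendsto_log_atTop.const_mul_atTop hK0
    obtain ⟨R, hR⟩ := ((eventually_gt_atTop 1).and (h1.eventually_gt_atTop M)).exists
    exact ⟨R, hR⟩
  have hR0 : 0 < R := by linarith
  have hε : 0 < R⁻¹ := by positivity
  refine ⟨R⁻¹, hε, hRM.trans_le ?_⟩
  rw [greenEntry_eq hε hβ, hK, mul_assoc]
  refine mul_le_mul_of_nonneg_left ?_ (inv_nonneg.2 hΓ.le)
  have hint := (green_representation (d := d) hε hβ 0 0).1
  have hsub : Ioc 1 R ⊆ Ioi 0 := fun t ht => one_pos.trans ht.1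
  have h1 : ∫ t in Ioc 1 R, c * Real.exp (-1) * t⁻¹ = c * Real.exp (-1) * Real.log R := by
    rw [integral_const_mul, ← intervalIntegral.integral_of_le hR1.le,
      integral_inv_of_pos one_pos hR0, div_one]
  have hinv : IntegrableOn (fun t : ℝ => t⁻¹) (Ioc 1 R) := by
    rw [← intervalIntegrable_iff_integrableOn_Ioc_of_le hR1.le]
    refine intervalIntegral.intervalIntegrable_inv (fun t ht => ?_) (by fun_prop)
    rw [uIcc_of_le hR1.le] at ht
    linarith [ht.1]
  have h2 : ∫ t in Ioc 1 R, c * Real.exp (-1) * t⁻¹ ≤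
      ∫ t in Ioc 1 R, t ^ (β - 1) * Real.exp (-R⁻¹ * t) * heatEntry t (0 : Lattice d) 0 := by
    refine setIntegral_mono_on (hinv.const_mul _) (hint.mono_set hsub) measurableSet_Ioc
      fun t ht => ?_
    have ht0 : 0 < t := hsub ht
    have h3 : Real.exp (-1) ≤ Real.exp (-R⁻¹ * t) := by
      rw [Real.exp_le_exp, neg_mul, neg_le_neg_iff, inv_mul_le_iff₀ hR0, mul_one]
      exact ht.2
    have h4 : t⁻¹ ≤ t ^ (β - 1) * t ^ (-(d / 2 : ℝ)) := by
      rw [← Real.rpow_add ht0, ← Real.rpow_neg_one]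
      exact Real.rpow_le_rpow_of_exponent_le ht.1.le (by linarith)
    have h5 := hcb t ht.1.le
    calc c * Real.exp (-1) * t⁻¹
        ≤ c * Real.exp (-R⁻¹ * t) * (t ^ (β - 1) * t ^ (-(d / 2 : ℝ))) := by gcongr
      _ = t ^ (β - 1) * Real.exp (-R⁻¹ * t) * (c * t ^ (-(d / 2 : ℝ))) := by ring
      _ ≤ _ := mul_le_mul_of_nonneg_left h5 (by positivity)
  rw [← h1]
  refine h2.trans (setIntegral_mono_set hint ?_ hsub.eventuallyLE)
  filter_upwards [ae_restrict_mem measurableSet_Ioi] with t ht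
  have ht0 : 0 < t := ht
  have hp := heatEntry_pos ht0 (0 : Lattice d) 0
  simp only [Pi.zero_apply]
  positivity

/-- The limit `ε → 0` in finite sums gives the upper bound; domination of the regularized kernels by
the Riesz kernels gives the lower one. -/
theorem hasSum_riesz_mul {d : ℕ} {β γ : ℝ} (hβ : 0 < β) (hγ : 0 < γ) (hd : β + γ < d / 2) :
    HasSum (fun x : Lattice d => riesz β x * riesz γ x) (riesz (β + γ) (0 : Lattice d)) := by
  have hβd : β < d / 2 := by linarith
  have hγd : γ < d / 2 := by linarith
  have hb : ∀ s : Finset (Lattice d), ∑ x ∈ s, riesz β x * riesz γ x ≤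
      riesz (β + γ) (0 : Lattice d) := fun s => by
    have ht : Tendsto (fun ε => ∑ x ∈ s, greenEntry ε β 0 x * greenEntry ε γ 0 x) (𝓝[>] 0)
        (𝓝 (∑ x ∈ s, riesz β x * riesz γ x)) :=
      tendsto_finsetSum s fun x _ => (tendsto_green hβ hβd x).mul (tendsto_green hγ hγd x)
    refine le_of_tendsto ht ?_
    filter_upwards [self_mem_nhdsWithin] with ε hε
    refine le_trans ?_ (green_le_riesz hε (add_pos hβ hγ) hd 0)
    exact sum_le_hasSum s (fun x _ => mul_nonneg (greenEntry_pos hε hβ 0 x).le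
      (greenEntry_pos hε hγ 0 x).le) (hasSum_green_mul hε hβ hγ)
  have hnn : ∀ x : Lattice d, 0 ≤ riesz β x * riesz γ x := fun x =>
    mul_nonneg (riesz_pos hβ hβd x).le (riesz_pos hγ hγd x).le
  have hs : Summable fun x : Lattice d => riesz β x * riesz γ x :=
    summable_of_sum_le hnn hb
  have hle : riesz (β + γ) (0 : Lattice d) ≤ ∑' x : Lattice d, riesz β x * riesz γ x := by
    refine le_of_tendsto (tendsto_green (add_pos hβ hγ) hd 0) ?_
    filter_upwards [self_mem_nhdsWithin] with ε hε
    exact hasSum_le (fun x => mul_le_mul (green_le_riesz hε hβ hβd x) (green_le_riesz hε hγ hγd x)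
      (greenEntry_pos hε hγ 0 x).le (riesz_pos hβ hβd x).le) (hasSum_green_mul hε hβ hγ) hs.hasSum
  rw [le_antisymm hle (hs.tsum_le_of_sum_le hb)]
  exact hs.hasSum

theorem not_summable_riesz_mul {d : ℕ} {β γ : ℝ} (hβ : 0 < β) (hγ : 0 < γ) (hβd : β < d / 2)
    (hγd : γ < d / 2) (hd : (d : ℝ) / 2 ≤ β + γ) :
    ¬ Summable fun x : Lattice d => riesz β x * riesz γ x := by
  intro hs
  obtain ⟨ε, hε, hM⟩ := green_zero_unbounded (d := d) (add_pos hβ hγ) hd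
    (∑' x : Lattice d, riesz β x * riesz γ x)
  refine hM.not_ge ?_
  exact hasSum_le (fun x => mul_le_mul (green_le_riesz hε hβ hβd x) (green_le_riesz hε hγ hγd x)
    (greenEntry_pos hε hγ 0 x).le (riesz_pos hβ hβd x).le) (hasSum_green_mul hε hβ hγ) hs.hasSum

/-! ### Signs of the off-diagonal entries of the fractional Laplacian. -/

theorem exists_spectrum_le {H : Type*} [NormedAddCommGroup H] [InnerProductSpace ℂ H]
    [CompleteSpace H] (T : H →L[ℂ] H) : ∃ M, 0 ≤ M ∧ ∀ z ∈ spectrum ℝ T, z ≤ M := by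
  obtain ⟨M, hM⟩ := (spectrum.isCompact (𝕜 := ℝ) T).bddAbove
  exact ⟨max M 0, le_max_right _ _, fun z hz => (hM hz).trans (le_max_left _ _)⟩

theorem fracLaplacian_eq_opFun (d : ℕ) (σ : ℝ) :
    fracLaplacian d σ = opFun (laplacian d) (fun s => s ^ σ) := rfl

/-- The matrix entries of the fractional Laplacian. -/
def fracEntry {d : ℕ} (σ : ℝ) (y x : Lattice d) : ℝ := (fracLaplacian d σ (delta y) x).re

theorem fracEntry_symm {d : ℕ} (σ : ℝ) (y x : Lattice d) : fracEntry σ y x = fracEntry σ x y :=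
  opFun_entry_symm d _ y x

/-- Write `s^σ = C ∫ t^σ (1/t - 1/(s+t)) dt`. Off the diagonal the multiple of the identity drops
out, leaving minus an integral of resolvent entries, which are strictly positive. -/
theorem fracEntry_neg_of_lt_one {d : ℕ} {σ : ℝ} (hσ0 : 0 < σ) (hσ1 : σ < 1) {y x : Lattice d}
    (hxy : x ≠ y) : fracEntry σ y x < 0 := by
  have hT := laplacian_nonneg d
  have hspec := spectrum_subset_Ici hT
  have hσ : σ ∈ Ioo (0 : ℝ) 1 := ⟨hσ0, hσ1⟩
  -- The integrand increases in `s`, so its value at a spectral bound `M` dominates.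
  obtain ⟨M, hM0, hM⟩ := exists_spectrum_le (laplacian d)
  set C := (∫ t in Ioi 0, Real.rpowIntegrand₀₁ σ t 1)⁻¹ with hC
  have hC0 : 0 < C := inv_pos.2 (Real.integral_rpowIntegrand₀₁_one_pos hσ)
  obtain ⟨h1, h2⟩ := opFun_setIntegral hT (μ := volume) (s := Ioi 0) measurableSet_Ioi
    (fun t s => C * Real.rpowIntegrand₀₁ σ t s) (fun t => C * Real.rpowIntegrand₀₁ σ t M)
    ((Real.continuousOn_rpowIntegrand₀₁_uncurry hσ _ hspec).const_mul C)
    (fun t ht z hz => by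
      have ht0 : (0 : ℝ) ≤ t := le_of_lt ht
      have hz0 : 0 ≤ z := hspec hz
      have := Real.rpowIntegrand₀₁_nonneg hσ0 ht0 hz0
      rw [abs_of_nonneg (by positivity)]
      exact mul_le_mul_of_nonneg_left
        (Real.rpowIntegrand₀₁_monotoneOn hσ ht0 hz0 hM0 (hM z hz)) hC0.le)
    ((Real.integrableOn_rpowIntegrand₀₁_Ioi hσ hM0).const_mul C) (entryCLM (delta y) x)
  have h3 : ∀ t ∈ Ioi (0 : ℝ), entryCLM (delta y) x (opFun (laplacian d)
      (fun s => C * Real.rpowIntegrand₀₁ σ t s)) =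
      ((-(C * t ^ σ * greenEntry t 1 y x) : ℝ) : ℂ) := fun t ht => by
    have ht0 : 0 < t := ht
    have hg := continuousOn_add_rpow ht0 (-1)
    have h4 : opFun (laplacian d) (fun s => C * Real.rpowIntegrand₀₁ σ t s) =
        opFun (laplacian d) (fun s => C * t ^ (σ - 1) - C * t ^ σ * (s + t) ^ (-1 : ℝ)) :=
      opFun_congr hT fun s hs => by
        rw [Real.rpowIntegrand₀₁_eq_sub hσ1.ne ht0, Real.rpow_neg_one]
        simp only
        rw [add_comm t s]
        ring
    have hcg : ContinuousOn (fun s => C * t ^ σ * (s + t) ^ (-1 : ℝ)) (Ici 0) :=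
      continuousOn_const.mul hg
    rw [h4, opFun_sub hT continuousOn_const hcg, opFun_const hT,
      opFun_const_mul hT _ hg, map_sub, entryCLM_apply, entryCLM_apply]
    have h5 : (((C * t ^ (σ - 1)) • (1 : L2 d →L[ℂ] L2 d)) (delta y) : L2 d) x = 0 := by
      change ((C * t ^ (σ - 1) : ℝ) • (delta y x) : ℂ) = 0
      simp [delta_apply, hxy]
    have h6 : (((C * t ^ σ) • opFun (laplacian d) (fun s => (s + t) ^ (-1 : ℝ))) (delta y) : L2 d) x
        = ((C * t ^ σ : ℝ) : ℂ) * opFun (laplacian d) (fun s => (s + t) ^ (-1 : ℝ)) (delta y) x :=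
      Complex.real_smul
    erw [h5, h6]
    rw [green_apply ht0 one_pos, zero_sub, ← Complex.ofReal_mul, ← Complex.ofReal_neg]
  rw [integrableOn_congr_fun h3 measurableSet_Ioi] at h1
  have h5 := h1.re
  simp only [RCLike.re_to_complex, Complex.ofReal_re] at h5
  have h7 : fracLaplacian d σ = opFun (laplacian d)
      (fun s => ∫ t in Ioi 0, C * Real.rpowIntegrand₀₁ σ t s) := by
    rw [fracLaplacian_eq_opFun]
    refine opFun_congr hT fun s hs => ?_
    rw [integral_const_mul]
    exact Real.rpow_eq_const_mul_integral hσ hs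
  rw [fracEntry, h7, ← entryCLM_apply, h2, setIntegral_congr_fun measurableSet_Ioi h3,
    integral_complex_ofReal, Complex.ofReal_re, integral_neg, neg_lt_zero]
  have hpos : ∀ t ∈ Ioi (0 : ℝ), 0 < C * t ^ σ * greenEntry t 1 y x := fun t ht =>
    mul_pos (mul_pos hC0 (Real.rpow_pos_of_pos ht _)) (greenEntry_pos ht one_pos y x)
  have h8 : IntegrableOn (fun t => C * t ^ σ * greenEntry t 1 y x) (Ioi 0) := by
    refine h5.neg.congr (ae_of_all _ fun t => ?_)
    simp
  have h9 : (Function.support fun t => C * t ^ σ * greenEntry t 1 y x) ∩ Ioi 0 = Ioi 0 :=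
    inter_eq_right.2 fun t ht => (hpos t ht).ne'
  rw [setIntegral_pos_iff_support_of_nonneg_ae
    ((ae_restrict_mem measurableSet_Ioi).mono fun t ht => (hpos t ht).le) h8, h9]
  simp

theorem fracLaplacian_one (d : ℕ) : fracLaplacian d 1 = laplacian d := by
  rw [fracLaplacian_eq_opFun]
  simp only [Real.rpow_one]
  exact opFun_id (laplacian_nonneg d)

theorem fracEntry_one {d : ℕ} {y x : Lattice d} (hxy : x ≠ y) :
    fracEntry 1 y x = -∑ i : Fin d, ((if x + Pi.single i 1 = y then (1 : ℝ) else 0) +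
      if x - Pi.single i 1 = y then 1 else 0) := by
  rw [fracEntry, fracLaplacian_one, laplacian_apply, Complex.re_sum, ← Finset.sum_neg_distrib]
  refine Finset.sum_congr rfl fun i _ => ?_
  simp only [delta_apply, hxy, if_false]
  split_ifs <;> norm_num

theorem fracEntry_nonpos {d : ℕ} {σ : ℝ} (hσ0 : 0 < σ) (hσ1 : σ ≤ 1) {y x : Lattice d}
    (hxy : x ≠ y) : fracEntry σ y x ≤ 0 := by
  rcases hσ1.lt_or_eq with h | rfl
  · exact (fracEntry_neg_of_lt_one hσ0 h hxy).le
  · rw [fracEntry_one hxy, neg_nonpos]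
    exact Finset.sum_nonneg fun i _ => by split_ifs <;> norm_num

theorem add_single_ne {d : ℕ} (x : Lattice d) (i : Fin d) : x + Pi.single i 1 ≠ x := by
  intro h
  have := congrFun h i
  simp at this

/-- For `σ = 1` only neighbours interact, so strictness is available uniformly in `σ` only along
edges; connectedness makes that enough. -/
theorem fracEntry_neighbour_neg {d : ℕ} {σ : ℝ} (hσ0 : 0 < σ) (hσ1 : σ ≤ 1) (x : Lattice d)
    (i : Fin d) : fracEntry σ (x + Pi.single i 1) x < 0 := by
  have hne := (add_single_ne x i).symm
  rcases hσ1.lt_or_eq with h | rfl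
  · exact fracEntry_neg_of_lt_one hσ0 h hne
  · rw [fracEntry_one hne, neg_lt_zero]
    refine Finset.sum_pos' (fun i _ => by split_ifs <;> norm_num) ⟨i, Finset.mem_univ _, ?_⟩
    rw [if_pos rfl]
    split_ifs <;> norm_num

/-! ### Ground state representation and the Hardy inequality with remainder. -/

theorem toL2_eq_sum {d : ℕ} (φ : Lattice d →₀ ℝ) {F : Finset (Lattice d)} (hF : φ.support ⊆ F) :
    toL2 φ = ∑ x ∈ F, (φ x : ℂ) • delta x := by
  simp only [← single_eq_smul_delta]
  refine Finset.sum_subset hF fun x _ hx => ?_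
  rw [Finsupp.notMem_support_iff.1 hx]
  simp

theorem form_eq_sum {d : ℕ} (σ : ℝ) (φ : Lattice d →₀ ℝ) {F : Finset (Lattice d)}
    (hF : φ.support ⊆ F) :
    form σ φ = ∑ x ∈ F, ∑ y ∈ F, fracEntry σ y x * (φ x * φ y) := by
  rw [form, toL2_eq_sum φ hF, map_sum, sum_inner, Complex.re_sum, Finset.sum_comm]
  refine Finset.sum_congr rfl fun y _ => ?_
  rw [inner_sum, Complex.re_sum]
  refine Finset.sum_congr rfl fun x _ => ?_
  rw [map_smul, inner_smul_left, inner_smul_right, inner_delta_right, fracEntry,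
    Complex.conj_ofReal, Complex.re_ofReal_mul, Complex.re_ofReal_mul, Complex.conj_re]
  ring

/-- The ground state representation on a finite set: a positive supersolution `u` bounds the
quadratic form from below by the weight plus any single difference term. -/
theorem ground_state_bound {ι : Type*} (F : Finset ι) (a : ι → ι → ℝ)
    (u w φ : ι → ℝ) (hsymm : ∀ x y, a y x = a x y) (ha : ∀ x y, x ≠ y → a y x ≤ 0)
    (hu : ∀ x, 0 < u x) (hsuper : ∀ x ∈ F, w x * u x ≤ ∑ y ∈ F, a y x * u y)
    {p q : ι} (hp : p ∈ F) (hq : q ∈ F) (hpq : p ≠ q) :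
    ∑ x ∈ F, w x * φ x ^ 2 + -a q p * (u p * u q) * (φ p / u p - φ q / u q) ^ 2 ≤
      ∑ x ∈ F, ∑ y ∈ F, a y x * (φ x * φ y) := by
  classical
  have h1 : ∑ x ∈ F, w x * φ x ^ 2 ≤ ∑ x ∈ F, ∑ y ∈ F, a y x * (u x * u y) * (φ x / u x) ^ 2 := by
    refine Finset.sum_le_sum fun x hx => ?_
    have hux := hu x
    have := mul_le_mul_of_nonneg_right (hsuper x hx) (show 0 ≤ φ x ^ 2 / u x by positivity)
    calc w x * φ x ^ 2 = w x * u x * (φ x ^ 2 / u x) := by field_simp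
      _ ≤ _ := this
      _ = _ := by
        rw [Finset.sum_mul]
        refine Finset.sum_congr rfl fun y _ => ?_
        field_simp
  have h2 : ∑ x ∈ F, ∑ y ∈ F, a y x * (u x * u y) * (φ x / u x) ^ 2 =
      ∑ x ∈ F, ∑ y ∈ F, a y x * (u x * u y) * (φ y / u y) ^ 2 := by
    rw [Finset.sum_comm]
    refine Finset.sum_congr rfl fun y _ => Finset.sum_congr rfl fun x _ => ?_
    rw [hsymm]
    ring
  have h3 : ∑ x ∈ F, ∑ y ∈ F, a y x * (φ x * φ y) =
      ∑ x ∈ F, ∑ y ∈ F, a y x * (u x * u y) * ((φ x / u x) * (φ y / u y)) := by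
    refine Finset.sum_congr rfl fun x _ => Finset.sum_congr rfl fun y _ => ?_
    have := hu x
    have := hu y
    field_simp
  -- With `a = φ x / u x` and `b = φ y / u y`, use `2ab = a² + b² - (a - b)²`; the diagonal, where
  -- the sign of `a x x` is unknown, contributes nothing to `g`.
  set g : ι → ι → ℝ := fun x y => -a y x * (u x * u y) * (φ x / u x - φ y / u y) ^ 2 with hg
  have hg0 : ∀ x y, 0 ≤ g x y := fun x y => by
    rcases eq_or_ne x y with rfl | h
    · simp [hg]
    · have := ha x y h
      have := hu x
      have := hu y
      exact mul_nonneg (mul_nonneg (by linarith) (by positivity)) (sq_nonneg _)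
  have h4 : ∑ x ∈ F, ∑ y ∈ F, g x y =
      2 * ∑ x ∈ F, ∑ y ∈ F, a y x * (u x * u y) * ((φ x / u x) * (φ y / u y)) -
      ∑ x ∈ F, ∑ y ∈ F, a y x * (u x * u y) * (φ x / u x) ^ 2 -
      ∑ x ∈ F, ∑ y ∈ F, a y x * (u x * u y) * (φ y / u y) ^ 2 := by
    rw [Finset.mul_sum, ← Finset.sum_sub_distrib, ← Finset.sum_sub_distrib]
    refine Finset.sum_congr rfl fun x _ => ?_
    rw [Finset.mul_sum, ← Finset.sum_sub_distrib, ← Finset.sum_sub_distrib]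
    refine Finset.sum_congr rfl fun y _ => ?_
    simp only [hg]
    ring
  -- Both orientations of the pair are kept; this compensates the factor `2` in `h4`.
  have h5 : g p q + g q p ≤ ∑ x ∈ F, ∑ y ∈ F, g x y := by
    calc g p q + g q p ≤ ∑ y ∈ F, g p y + ∑ y ∈ F, g q y :=
          add_le_add (Finset.single_le_sum (fun y _ => hg0 p y) hq)
            (Finset.single_le_sum (fun y _ => hg0 q y) hp)
      _ = ∑ x ∈ ({p, q} : Finset ι), ∑ y ∈ F, g x y := (Finset.sum_pair (f := fun x => ∑ y ∈ F, g x y) hpq).symm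
      _ ≤ _ := Finset.sum_le_sum_of_subset_of_nonneg
          (by intro x hx; simp at hx; rcases hx with rfl | rfl <;> assumption)
          fun x _ _ => Finset.sum_nonneg fun y _ => hg0 x y
  have h6 : g q p = g p q := by
    simp only [hg]
    rw [hsymm]
    ring
  have h7 : g p q = -a q p * (u p * u q) * (φ p / u p - φ q / u q) ^ 2 := rfl
  rw [← h7, h3]
  linarith

theorem continuous_rpow_of_pos {σ : ℝ} (hσ : 0 < σ) : Continuous fun s : ℝ => s ^ σ :=
  Real.continuous_rpow_const hσ.le

/-- Monotonicity and subadditivity of `s ↦ s^σ`, the latter using `σ ≤ 1`. The gap is the error in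
replacing `Δ^σ (Δ+ε)^{-β}` by `(Δ+ε)^{-(β-σ)}`. -/
theorem rpow_gap_bounds {ε σ s : ℝ} (hε : 0 < ε) (hσ0 : 0 < σ) (hσ1 : σ ≤ 1) (hs : 0 ≤ s)
    (β : ℝ) : 0 ≤ (s + ε) ^ (-(β - σ)) - s ^ σ * (s + ε) ^ (-β) ∧
      (s + ε) ^ (-(β - σ)) - s ^ σ * (s + ε) ^ (-β) ≤ ε ^ σ * (s + ε) ^ (-β) := by
  have hpos : 0 < s + ε := by linarith
  have h1 : (s + ε) ^ (-(β - σ)) = (s + ε) ^ σ * (s + ε) ^ (-β) := by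
    rw [← Real.rpow_add hpos]
    congr 1
    ring
  have h2 : s ^ σ ≤ (s + ε) ^ σ := Real.rpow_le_rpow hs (by linarith) hσ0.le
  have h3 : (s + ε) ^ σ ≤ s ^ σ + ε ^ σ := Real.rpow_add_le_add_rpow hs hε.le hσ0.le hσ1
  have h4 : 0 < (s + ε) ^ (-β) := Real.rpow_pos_of_pos hpos _
  rw [h1]
  constructor <;> nlinarith

/-- The gap function is nonnegative, so each entry of its operator is at most the diagonal one,
which is `O(ε^σ)` uniformly in `x`. -/
theorem green_sub_le_fracLaplacian {d : ℕ} {ε σ α : ℝ} (hε : 0 < ε) (hσ0 : 0 < σ) (hσ1 : σ ≤ 1)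
    (hαd : α < d / 2) (hα : σ < α) (x : Lattice d) :
    greenEntry ε (α - σ) 0 x - ε ^ σ * riesz α (0 : Lattice d) ≤
      (fracLaplacian d σ (opFun (laplacian d) (fun s => (s + ε) ^ (-α)) (delta 0)) x).re := by
  have hT := laplacian_nonneg d
  have hα0 : 0 < α := hσ0.trans hα
  have hc := (continuous_rpow_of_pos hσ0).continuousOn (s := Ici 0)
  have hg := continuousOn_add_rpow hε (-α)
  have hg' := continuousOn_add_rpow hε (-(α - σ))
  have hD : ContinuousOn (fun s => (s + ε) ^ (-(α - σ)) - s ^ σ * (s + ε) ^ (-α)) (Ici 0) :=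
    hg'.sub (hc.mul hg)
  have hm : ContinuousOn (fun s => s ^ σ * (s + ε) ^ (-α)) (Ici 0) := hc.mul hg
  have h1 := opFun_entry_le_diag d hD (fun s hs => (rpow_gap_bounds hε hσ0 hσ1 hs α).1) x 0
  have h2 := opFun_entry_mono d hD (hg.const_mul (ε ^ σ))
    (fun s hs => (rpow_gap_bounds hε hσ0 hσ1 hs α).2) 0
  rw [opFun_const_mul hT _ hg] at h2
  have h3 : ((((ε ^ σ) • opFun (laplacian d) (fun s => (s + ε) ^ (-α))) (delta 0) : L2 d) 0).re =
      ε ^ σ * greenEntry ε α (0 : Lattice d) 0 := Complex.smul_re _ _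
  rw [opFun_sub hT hg' hm] at h1 h2
  have h4 : ((((opFun (laplacian d) (fun s => (s + ε) ^ (-(α - σ))) -
      opFun (laplacian d) (fun s => s ^ σ * (s + ε) ^ (-α))) (delta 0)) : L2 d) x).re =
      greenEntry ε (α - σ) 0 x -
        (fracLaplacian d σ (opFun (laplacian d) (fun s => (s + ε) ^ (-α)) (delta 0)) x).re := by
    rw [fracLaplacian_eq_opFun, ← opFun_mul hT hc hg, greenEntry, ← Complex.sub_re]
    rfl
  have h5 := green_le_riesz hε hα0 hαd (0 : Lattice d)
  have h6 : ε ^ σ * greenEntry ε α (0 : Lattice d) 0 ≤ ε ^ σ * riesz α (0 : Lattice d) :=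
    mul_le_mul_of_nonneg_left h5 (by positivity)
  have h7 := h1.trans h2
  rw [h4] at h7
  have h8 := h7.trans_eq h3
  linarith

/-- Since `x ∈ F`, the terms outside `F` are off-diagonal and nonpositive, so truncation to `F` only
increases the sum. An inequality over finite sets suffices, and `ε → 0` is then taken in finitely
many terms. -/
theorem riesz_supersolution {d : ℕ} {σ α : ℝ} (hσ0 : 0 < σ) (hσ1 : σ ≤ 1) (hα : σ < α)
    (hαd : α < d / 2) {F : Finset (Lattice d)} {x : Lattice d} (hx : x ∈ F) :
    riesz (α - σ) x ≤ ∑ y ∈ F, fracEntry σ y x * riesz α y := by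
  have hα0 : 0 < α := hσ0.trans hα
  have h1 : Tendsto (fun ε => ∑ y ∈ F, fracEntry σ y x * greenEntry ε α 0 y) (𝓝[>] 0)
      (𝓝 (∑ y ∈ F, fracEntry σ y x * riesz α y)) :=
    tendsto_finsetSum F fun y _ => (tendsto_green hα0 hαd y).const_mul _
  have h2 : Tendsto (fun ε => greenEntry ε (α - σ) 0 x - ε ^ σ * riesz α (0 : Lattice d)) (𝓝[>] 0)
      (𝓝 (riesz (α - σ) x - 0 ^ σ * riesz α (0 : Lattice d))) :=
    (tendsto_green (by linarith) (by linarith) x).sub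
      ((((continuous_rpow_of_pos hσ0).tendsto 0).mono_left nhdsWithin_le_nhds).mul_const _)
  rw [Real.zero_rpow hσ0.ne', zero_mul, sub_zero] at h2
  refine le_of_tendsto_of_tendsto h2 h1 ?_
  filter_upwards [self_mem_nhdsWithin] with ε hε
  refine (green_sub_le_fracLaplacian hε hσ0 hσ1 hαd hα x).trans ?_
  have h3 := Complex.hasSum_re (hasSum_apply_delta (fracLaplacian d σ)
    (opFun (laplacian d) (fun s => (s + ε) ^ (-α)) (delta 0)) x)
  simp only [green_apply hε hα0, Complex.re_ofReal_mul] at h3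
  have h4 := sum_le_hasSum F (fun y hy => ?_) h3.neg
  · rw [Finset.sum_neg_distrib, neg_le_neg_iff] at h4
    refine h4.trans_eq (Finset.sum_congr rfl fun y _ => mul_comm _ _)
  · have hne : x ≠ y := fun h => hy (h ▸ hx)
    have := fracEntry_nonpos hσ0 hσ1 hne
    have h5 := greenEntry_pos hε hα0 0 y
    have h6 : greenEntry ε α 0 y * fracEntry σ y x ≤ 0 := mul_nonpos_of_nonneg_of_nonpos h5.le this
    exact neg_nonneg.2 h6

theorem hardyWeight_eq {d : ℕ} {σ α : ℝ} (hσ0 : 0 < σ) (hα : σ < α) (x : Lattice d) :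
    hardyWeight d σ α x = riesz (α - σ) x / riesz α x := by
  rw [hardyWeight, ← neg_sub, rieszKernel_neg (by linarith), rieszKernel_neg (by linarith)]

theorem hardyWeight_pos {d : ℕ} {σ α : ℝ} (hσ0 : 0 < σ) (hα : σ < α) (hαd : α < d / 2)
    (x : Lattice d) : 0 < hardyWeight d σ α x := by
  rw [hardyWeight_eq hσ0 hα]
  exact div_pos (riesz_pos (by linarith) (by linarith) x) (riesz_pos (by linarith) hαd x)

/-- `F` is independent of the support of `φ`, so that it can stay fixed while `φ` runs through an
approximating sequence. -/
theorem hardy_with_remainder {d : ℕ} {σ α : ℝ} (hσ0 : 0 < σ) (hσ1 : σ ≤ 1) (hα : σ < α)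
    (hαd : α < d / 2) (φ : Lattice d →₀ ℝ) (F : Finset (Lattice d)) (x : Lattice d) (i : Fin d) :
    ∑ y ∈ F, hardyWeight d σ α y * φ y ^ 2 +
      -fracEntry σ (x + Pi.single i 1) x * (riesz α x * riesz α (x + Pi.single i 1)) *
        (φ x / riesz α x - φ (x + Pi.single i 1) / riesz α (x + Pi.single i 1)) ^ 2 ≤
      form σ φ := by
  classical
  set F' := F ∪ φ.support ∪ {x, x + Pi.single i 1} with hF'
  have hu : ∀ x : Lattice d, 0 < riesz α x := riesz_pos (hσ0.trans hα) hαd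
  have h := ground_state_bound F' (fracEntry σ) (riesz α) (hardyWeight d σ α) φ
    (fun x y => fracEntry_symm σ y x) (fun x y hxy => fracEntry_nonpos hσ0 hσ1 hxy) hu
    (fun x hx => by
      rw [hardyWeight_eq hσ0 hα, div_mul_cancel₀ _ (hu x).ne']
      exact riesz_supersolution hσ0 hσ1 hα hαd hx)
    (p := x) (q := x + Pi.single i 1) (by simp [hF']) (by simp [hF']) (add_single_ne x i).symm
  rw [form_eq_sum σ φ (F := F') (by intro z hz; simp [hF'] at hz ⊢; tauto)]
  refine le_trans (add_le_add_left ?_ _) h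
  exact Finset.sum_le_sum_of_subset_of_nonneg (by intro z hz; simp [hF', hz])
    fun z _ _ => mul_nonneg (hardyWeight_pos hσ0 hα hαd z).le (sq_nonneg _)

/-! ### The Riesz kernel has finite energy when `2α - σ < d/2`. -/

section FunctionalCalculusNorm

variable {H : Type*} [NormedAddCommGroup H] [InnerProductSpace ℂ H] [CompleteSpace H]

theorem norm_sq_opFun {T : H →L[ℂ] H} (hT : 0 ≤ T) {g : ℝ → ℝ} (hg : ContinuousOn g (Ici 0))
    (f : H) : ‖opFun T g f‖ ^ 2 = (inner ℂ (opFun T (fun s => g s * g s) f) f).re := by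
  rw [opFun_mul hT hg hg, opFun_symm]
  exact (inner_self_eq_norm_sq (𝕜 := ℂ) _).symm

/-- For `0 ≤ h ≤ g` one has `(g - h)² ≤ g² - h²`. Convergence of the norms of a monotone family thus
makes the vectors Cauchy. -/
theorem norm_sub_sq_opFun_le {T : H →L[ℂ] H} (hT : 0 ≤ T) {g h : ℝ → ℝ}
    (hg : ContinuousOn g (Ici 0)) (hh : ContinuousOn h (Ici 0)) (hh0 : ∀ s, 0 ≤ s → 0 ≤ h s)
    (hhg : ∀ s, 0 ≤ s → h s ≤ g s) (f : H) :
    ‖opFun T g f - opFun T h f‖ ^ 2 ≤ ‖opFun T g f‖ ^ 2 - ‖opFun T h f‖ ^ 2 := by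
  have hd : ContinuousOn (fun s => g s - h s) (Ici 0) := hg.sub hh
  have hgg : ContinuousOn (fun s => g s * g s) (Ici 0) := hg.mul hg
  have hhh : ContinuousOn (fun s => h s * h s) (Ici 0) := hh.mul hh
  have h1 : opFun T g f - opFun T h f = opFun T (fun s => g s - h s) f := by
    rw [opFun_sub hT hg hh]; rfl
  have h2 := re_inner_opFun_mono hT (g := fun s => (g s - h s) * (g s - h s))
    (h := fun s => g s * g s - h s * h s) (hd.mul hd) (hgg.sub hhh)
    (fun s hs => by nlinarith [hh0 s hs, hhg s hs]) f
  rw [opFun_sub hT hgg hhh, sub_apply, inner_sub_left, Complex.sub_re] at h2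
  rwa [h1, norm_sq_opFun hT hd, norm_sq_opFun hT hg, norm_sq_opFun hT hh]

end FunctionalCalculusNorm

theorem form_eq_norm_sq {d : ℕ} {σ : ℝ} (hσ : 0 < σ) (φ : Lattice d →₀ ℝ) :
    form σ φ = ‖opFun (laplacian d) (fun s => s ^ (σ / 2)) (toL2 φ)‖ ^ 2 := by
  have hT := laplacian_nonneg d
  rw [norm_sq_opFun hT (continuous_rpow_of_pos (half_pos hσ)).continuousOn, form,
    fracLaplacian_eq_opFun]
  rw [opFun_congr hT (g := fun s => s ^ σ) (h := fun s => s ^ (σ / 2) * s ^ (σ / 2))]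
  intro s hs
  have hs' : 0 ≤ s := hs
  simp only
  rw [← Real.rpow_add_of_nonneg hs' (half_pos hσ).le (half_pos hσ).le, add_halves]

theorem toL2_sub {d : ℕ} (φ ψ : Lattice d →₀ ℝ) : toL2 (φ - ψ) = toL2 φ - toL2 ψ := by
  ext x
  simp [toL2_apply]

theorem exists_toL2_near {d : ℕ} (f : L2 d) (g : Lattice d → ℝ) (hf : ∀ x, f x = (g x : ℂ))
    {r : ℝ} (hr : 0 < r) : ∃ φ : Lattice d →₀ ℝ, ‖toL2 φ - f‖ < r := by
  classical
  have h := (lp.hasSum_single (p := 2) (by simp) f).eventually (Metric.ball_mem_nhds f hr)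
  obtain ⟨s, hs⟩ := h.exists
  refine ⟨∑ x ∈ s, Finsupp.single x (g x), ?_⟩
  have h2 : toL2 (∑ x ∈ s, Finsupp.single x (g x)) = ∑ x ∈ s, lp.single 2 x (f x) := by
    ext z
    rw [toL2_apply, lp.coeFn_sum, Finset.sum_apply, Finsupp.finsetSum_apply]
    simp only [lp.single_apply, Pi.single_apply, Finsupp.single_apply, hf]
    push_cast
    refine Finset.sum_congr rfl fun x _ => ?_
    by_cases hxz : x = z
    · simp [hxz]
    · simp [hxz, Ne.symm hxz]
  rw [h2, ← dist_eq_norm]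
  exact hs

/-- The vector `Δ^{σ/2} (Δ + ε)^{-α} 1_0`. -/
def energyVec (d : ℕ) (σ α ε : ℝ) : L2 d :=
  opFun (laplacian d) (fun s => s ^ (σ / 2) * (s + ε) ^ (-α)) (delta 0)

theorem continuousOn_energy {σ ε : ℝ} (hσ : 0 < σ) (hε : 0 < ε) (α : ℝ) :
    ContinuousOn (fun s : ℝ => s ^ (σ / 2) * (s + ε) ^ (-α)) (Ici 0) :=
  (continuous_rpow_of_pos (half_pos hσ)).continuousOn.mul (continuousOn_add_rpow hε _)

theorem norm_energyVec_sub_sq_le (d : ℕ) {σ α ε δ : ℝ} (hσ : 0 < σ) (hα : 0 ≤ α) (hδ : 0 < δ)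
    (hδε : δ ≤ ε) :
    ‖energyVec d σ α δ - energyVec d σ α ε‖ ^ 2 ≤
      ‖energyVec d σ α δ‖ ^ 2 - ‖energyVec d σ α ε‖ ^ 2 := by
  refine norm_sub_sq_opFun_le (laplacian_nonneg d) (continuousOn_energy hσ hδ α)
    (continuousOn_energy hσ (hδ.trans_le hδε) α) (fun s hs => ?_) (fun s hs => ?_) _
  · have : 0 < s + ε := by linarith
    positivity
  · exact mul_le_mul_of_nonneg_left
      (Real.rpow_le_rpow_of_nonpos (by linarith) (by linarith) (by linarith)) (by positivity)

theorem norm_energyVec_sq (d : ℕ) {σ α ε : ℝ} (hσ : 0 < σ) (hε : 0 < ε) :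
    ‖energyVec d σ α ε‖ ^ 2 =
      (opFun (laplacian d) (fun s => s ^ σ * (s + ε) ^ (-(2 * α))) (delta 0) 0).re := by
  have hT := laplacian_nonneg d
  rw [energyVec, norm_sq_opFun hT (continuousOn_energy hσ hε α), inner_delta_right,
    Complex.conj_re, opFun_congr hT (h := fun s => s ^ σ * (s + ε) ^ (-(2 * α)))]
  intro s hs
  have hs' : 0 ≤ s := hs
  have hpos : 0 < s + ε := by linarith
  have h1 : s ^ σ = s ^ (σ / 2) * s ^ (σ / 2) := by
    rw [← Real.rpow_add_of_nonneg hs' (half_pos hσ).le (half_pos hσ).le, add_halves]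
  have h2 : (s + ε) ^ (-(2 * α)) = (s + ε) ^ (-α) * (s + ε) ^ (-α) := by
    rw [← Real.rpow_add hpos]
    congr 1
    ring
  simp only
  rw [h1, h2]
  ring

theorem tendsto_norm_energyVec_sq {d : ℕ} {σ α : ℝ} (hσ0 : 0 < σ) (hσ1 : σ ≤ 1) (hα : σ < α)
    (hd : 2 * α - σ < d / 2) :
    Tendsto (fun ε => ‖energyVec d σ α ε‖ ^ 2) (𝓝[>] 0)
      (𝓝 (riesz (2 * α - σ) (0 : Lattice d))) := by
  have hT := laplacian_nonneg d
  have hβ : 0 < 2 * α - σ := by linarith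
  -- The error `ε^σ (s+ε)^{-2α}` cannot be bounded through `κ_{-2α}(0)`, since `2α` may exceed
  -- `d/2`. Trading `ε^{σ-η}` for `(s+ε)^{σ-η}` keeps the index `2α - σ + η` below `d/2`.
  set η := min σ ((d / 2 - (2 * α - σ)) / 2) with hη
  have hη0 : 0 < η := lt_min hσ0 (by linarith)
  have hησ : η ≤ σ := min_le_left _ _
  have hηd : 2 * α - σ + η < d / 2 := by
    have : η ≤ (d / 2 - (2 * α - σ)) / 2 := min_le_right _ _
    linarith
  have hlow : Tendsto (fun ε => greenEntry ε (2 * α - σ) (0 : Lattice d) 0 -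
      ε ^ η * riesz (2 * α - σ + η) (0 : Lattice d)) (𝓝[>] 0)
      (𝓝 (riesz (2 * α - σ) (0 : Lattice d) - 0 ^ η * riesz (2 * α - σ + η) (0 : Lattice d))) :=
    (tendsto_green hβ hd 0).sub
      ((((continuous_rpow_of_pos hη0).tendsto 0).mono_left nhdsWithin_le_nhds).mul_const _)
  rw [Real.zero_rpow hη0.ne', zero_mul, sub_zero] at hlow
  refine tendsto_of_tendsto_of_tendsto_of_le_of_le' hlow (tendsto_green hβ hd 0) ?_ ?_
  · filter_upwards [self_mem_nhdsWithin] with ε hε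
    have hε0 : 0 < ε := hε
    have hg := continuousOn_add_rpow hε0 (-(2 * α - σ))
    have hg' := continuousOn_add_rpow hε0 (-(2 * α - σ + η))
    have hcg : ContinuousOn (fun s => ε ^ η * (s + ε) ^ (-(2 * α - σ + η))) (Ici 0) :=
      continuousOn_const.mul hg'
    have h1 := opFun_entry_mono d (hg.sub hcg)
      ((continuous_rpow_of_pos hσ0).continuousOn.mul (continuousOn_add_rpow hε0 (-(2 * α))))
      (fun s hs => by
        have hpos : 0 < s + ε := by linarith
        have h2 := (rpow_gap_bounds hε0 hσ0 hσ1 hs (2 * α)).2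
        have h3 : ε ^ σ * (s + ε) ^ (-(2 * α)) ≤ ε ^ η * (s + ε) ^ (-(2 * α - σ + η)) := by
          have h4 : ε ^ σ = ε ^ η * ε ^ (σ - η) := by
            rw [← Real.rpow_add hε0]; congr 1; ring
          have h5 : (s + ε) ^ (-(2 * α - σ + η)) = (s + ε) ^ (σ - η) * (s + ε) ^ (-(2 * α)) := by
            rw [← Real.rpow_add hpos]; congr 1; ring
          have h6 : ε ^ (σ - η) ≤ (s + ε) ^ (σ - η) :=
            Real.rpow_le_rpow hε0.le (by linarith) (by linarith)
          rw [h4, h5, mul_assoc]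
          gcongr
        simp only [Pi.sub_apply, Pi.mul_apply]
        linarith) 0
    have h7 : opFun (laplacian d) ((fun s => (s + ε) ^ (-(2 * α - σ))) -
        fun s => ε ^ η * (s + ε) ^ (-(2 * α - σ + η))) =
        opFun (laplacian d) (fun s => (s + ε) ^ (-(2 * α - σ))) -
        ε ^ η • opFun (laplacian d) (fun s => (s + ε) ^ (-(2 * α - σ + η))) := by
      refine (opFun_sub hT hg hcg).trans ?_
      exact congrArg _ (opFun_const_mul hT _ hg')
    have h8 : ((((opFun (laplacian d) (fun s => (s + ε) ^ (-(2 * α - σ))) -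
        ε ^ η • opFun (laplacian d) (fun s => (s + ε) ^ (-(2 * α - σ + η)))) (delta 0)) : L2 d)
        0).re = greenEntry ε (2 * α - σ) (0 : Lattice d) 0 -
          ε ^ η * greenEntry ε (2 * α - σ + η) (0 : Lattice d) 0 := by
      rw [greenEntry, greenEntry, ← Complex.re_ofReal_mul, ← Complex.sub_re]
      rfl
    rw [h7] at h1
    have h9 := h8.symm.trans_le h1
    rw [norm_energyVec_sq d hσ0 hε0]
    refine le_trans (sub_le_sub_left (mul_le_mul_of_nonneg_left
      (green_le_riesz hε0 (by linarith) hηd 0) (by positivity)) _) h9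
  · filter_upwards [self_mem_nhdsWithin] with ε hε
    have hε0 : 0 < ε := hε
    rw [norm_energyVec_sq d hσ0 hε0]
    exact opFun_entry_mono d
      ((continuous_rpow_of_pos hσ0).continuousOn.mul (continuousOn_add_rpow hε0 (-(2 * α))))
      (continuousOn_add_rpow hε0 (-(2 * α - σ)))
      (fun s hs => sub_nonneg.1 (rpow_gap_bounds hε0 hσ0 hσ1 hs (2 * α)).1) 0

/-- The approximants are finitely supported functions close in `ℓ²` to `(Δ + ε)^{-α} 1_0`. As
`Δ^{σ/2}` is bounded, the `ℓ²` error also disappears from the energy, and the vectors `Δ^{σ/2} (Δ +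
ε)^{-α} 1_0` converge. -/
theorem hasEnergy_riesz {d : ℕ} {σ α : ℝ} (hσ0 : 0 < σ) (hσ1 : σ ≤ 1) (hα : σ < α)
    (hαd : α < d / 2) (hd : 2 * α - σ < d / 2) :
    HasEnergy σ (riesz α : Lattice d → ℝ) (riesz (2 * α - σ) (0 : Lattice d)) := by
  have hT := laplacian_nonneg d
  have hα0 : 0 < α := hσ0.trans hα
  set e : ℕ → ℝ := fun n => 1 / ((n : ℝ) + 1) with he
  have he0 : ∀ n, 0 < e n := fun n => Nat.one_div_pos_of_nat
  have he1 : Tendsto e atTop (𝓝 0) := tendsto_one_div_add_atTop_nhds_zero_nat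
  have he2 : Tendsto e atTop (𝓝[>] 0) :=
    tendsto_nhdsWithin_iff.2 ⟨he1, Eventually.of_forall he0⟩
  set U : ℕ → L2 d := fun n => opFun (laplacian d) (fun s => (s + e n) ^ (-α)) (delta 0) with hU
  have hUx : ∀ n x, U n x = (greenEntry (e n) α 0 x : ℂ) := fun n x => green_apply (he0 n) hα0 0 x
  choose φ hφ using fun n => exists_toL2_near (U n) _ (hUx n) (he0 n)
  set S : L2 d →L[ℂ] L2 d := opFun (laplacian d) (fun s => s ^ (σ / 2)) with hS
  have hSU : ∀ n, S (U n) = energyVec d σ α (e n) := fun n =>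
    (opFun_mul hT (continuous_rpow_of_pos (half_pos hσ0)).continuousOn
      (continuousOn_add_rpow (he0 n) _) _).symm
  have hq : Tendsto (fun n => ‖S (U n)‖ ^ 2) atTop (𝓝 (riesz (2 * α - σ) (0 : Lattice d))) := by
    simp only [hSU]
    exact (tendsto_norm_energyVec_sq hσ0 hσ1 hα hd).comp he2
  have hsub : ∀ m n, ‖S (U m) - S (U n)‖ ^ 2 ≤ |‖S (U m)‖ ^ 2 - ‖S (U n)‖ ^ 2| := by
    intro m n
    simp only [hSU]
    rcases le_total (e m) (e n) with h | h
    · exact (norm_energyVec_sub_sq_le d hσ0 hα0.le (he0 m) h).trans (le_abs_self _)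
    · rw [norm_sub_rev, abs_sub_comm]
      exact (norm_energyVec_sub_sq_le d hσ0 hα0.le (he0 n) h).trans (le_abs_self _)
  have hcau : CauchySeq fun n => S (U n) := by
    rw [Metric.cauchySeq_iff]
    intro ε hε
    obtain ⟨N, hN⟩ := Metric.cauchySeq_iff.1 hq.cauchySeq (ε ^ 2) (by positivity)
    refine ⟨N, fun m hm n hn => ?_⟩
    rw [dist_eq_norm]
    exact lt_of_pow_lt_pow_left₀ 2 hε.le ((hsub m n).trans_lt (hN m hm n hn))
  obtain ⟨B, hB⟩ := cauchySeq_tendsto_of_complete hcau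
  have hφU : Tendsto (fun n => toL2 (φ n) - U n) atTop (𝓝 0) :=
    squeeze_zero_norm (fun n => (hφ n).le) he1
  have hSφ : Tendsto (fun n => S (toL2 (φ n))) atTop (𝓝 B) := by
    have h := ((S.continuous.tendsto 0).comp hφU).add hB
    rw [map_zero, zero_add] at h
    refine h.congr fun n => ?_
    simp
  have hE : ‖B‖ ^ 2 = riesz (2 * α - σ) (0 : Lattice d) :=
    tendsto_nhds_unique (hB.norm.pow 2) hq
  have hpt : ∀ x, Tendsto (fun n => φ n x) atTop (𝓝 (riesz α x)) := by
    intro x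
    have h := (((evalAt x).continuous.tendsto 0).comp hφU)
    rw [map_zero] at h
    have h2 := ((Complex.continuous_re.tendsto 0).comp h).add
      ((tendsto_green hα0 hαd x).comp he2)
    rw [Complex.zero_re, zero_add] at h2
    refine h2.congr fun n => ?_
    have h3 : evalAt x (toL2 (φ n) - U n) = (φ n x : ℂ) - (greenEntry (e n) α 0 x : ℂ) := by
      rw [map_sub, evalAt_apply, evalAt_apply, hUx, toL2_apply]
    simp only [Function.comp_apply, h3, Complex.sub_re, Complex.ofReal_re]
    ring
  refine ⟨φ, fun ε hε => ?_, hpt, ?_⟩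
  · obtain ⟨N1, hN1⟩ := Metric.cauchySeq_iff.1 hSφ.cauchySeq (ε / 2) (half_pos hε)
    obtain ⟨N2, hN2⟩ := Metric.cauchySeq_iff.1 (hpt 0).cauchySeq (ε / 2) (half_pos hε)
    refine ⟨max N1 N2, fun m hm n hn => ?_⟩
    have h1 := hN1 m (le_of_max_le_left hm) n (le_of_max_le_left hn)
    have h2 := hN2 m (le_of_max_le_right hm) n (le_of_max_le_right hn)
    rw [dist_eq_norm, ← map_sub, ← toL2_sub] at h1
    rw [Real.dist_eq] at h2
    rw [form_eq_norm_sq hσ0, Finsupp.sub_apply, Real.sqrt_lt' hε]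
    set p := ‖S (toL2 (φ m - φ n))‖
    have hp : 0 ≤ p := norm_nonneg _
    have hr : 0 ≤ |φ m 0 - φ n 0| := abs_nonneg _
    nlinarith
  · rw [← hE]
    refine (hSφ.norm.pow 2).congr fun n => ?_
    rw [form_eq_norm_sq hσ0]

/-! ### Criticality, uniqueness of minimizers and the threshold. -/

theorem isHardyWeight_hardyWeight {d : ℕ} (hd : 1 ≤ d) {σ α : ℝ} (hσ0 : 0 < σ) (hσ1 : σ ≤ 1)
    (hα : σ < α) (hαd : α < d / 2) : IsHardyWeight σ (hardyWeight d σ α) := by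
  refine ⟨fun x => (hardyWeight_pos hσ0 hα hαd x).le, fun φ => ?_⟩
  refine le_trans ?_ (hardy_with_remainder hσ0 hσ1 hα hαd φ φ.support 0 ⟨0, hd⟩)
  have h1 := fracEntry_neighbour_neg hσ0 hσ1 (0 : Lattice d) ⟨0, hd⟩
  have h2 := riesz_pos (hσ0.trans hα) hαd (0 : Lattice d)
  have h3 := riesz_pos (hσ0.trans hα) hαd ((0 : Lattice d) + Pi.single ⟨0, hd⟩ 1)
  exact le_add_of_nonneg_right
    (mul_nonneg (mul_nonneg (by linarith) (mul_pos h2 h3).le) (sq_nonneg _))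

theorem IsHardyWeight.sum_le_form {d : ℕ} {σ : ℝ} {w : Lattice d → ℝ} (hw : IsHardyWeight σ w)
    (φ : Lattice d →₀ ℝ) (F : Finset (Lattice d)) : ∑ x ∈ F, w x * φ x ^ 2 ≤ form σ φ := by
  classical
  have h1 : ∑ x ∈ φ.support ∪ F, w x * φ x ^ 2 = ∑ x ∈ φ.support, w x * φ x ^ 2 := by
    refine (Finset.sum_subset Finset.subset_union_left fun x _ hx => ?_).symm
    rw [Finsupp.notMem_support_iff.1 hx]
    ring
  calc ∑ x ∈ F, w x * φ x ^ 2 ≤ ∑ x ∈ φ.support ∪ F, w x * φ x ^ 2 :=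
        Finset.sum_le_sum_of_subset_of_nonneg Finset.subset_union_right
          fun x _ _ => mul_nonneg (hw.1 x) (sq_nonneg _)
    _ ≤ form σ φ := h1 ▸ hw.2 φ

theorem IsHardyWeight.sum_le_energy {d : ℕ} {σ : ℝ} {w : Lattice d → ℝ} (hw : IsHardyWeight σ w)
    {v : Lattice d → ℝ} {E : ℝ} (hv : HasEnergy σ v E) (F : Finset (Lattice d)) :
    ∑ x ∈ F, w x * v x ^ 2 ≤ E := by
  obtain ⟨φ, -, hp, hE⟩ := hv
  exact le_of_tendsto_of_tendsto'
    (tendsto_finsetSum F fun x _ => ((hp x).pow 2).const_mul (w x)) hE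
    fun n => hw.sum_le_form (φ n) F

/-- A Hardy weight with a strictly positive minimizer is critical. -/
theorem IsHardyWeight.isCritical_of_minimizer {d : ℕ} {σ : ℝ} {w : Lattice d → ℝ}
    (hw : IsHardyWeight σ w) {v : Lattice d → ℝ} {E : ℝ} (hv0 : ∀ x, 0 < v x)
    (hv : HasEnergy σ v E) (hs : HasSum (fun x => w x * v x ^ 2) E) : IsCritical σ w := by
  refine ⟨hw, fun w' hw' hle => funext fun x => le_antisymm ?_ (hle x)⟩
  have hs' : Summable fun y => w' y * v y ^ 2 := summable_of_sum_le
    (fun y => mul_nonneg (hw'.1 y) (sq_nonneg (v y))) (hw'.sum_le_energy hv)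
  have h2 : ∑' y, w' y * v y ^ 2 ≤ E := hs'.tsum_le_of_sum_le (hw'.sum_le_energy hv)
  -- All terms of `∑ (w' - w) v²` are nonnegative and the total is at most `E - E = 0`.
  have h3 := le_hasSum (hs'.hasSum.sub hs) x fun y _ =>
    sub_nonneg.2 (mul_le_mul_of_nonneg_right (hle y) (sq_nonneg (v y)))
  have h4 : 0 < v x ^ 2 := pow_pos (hv0 x) 2
  nlinarith

theorem hardyWeight_mul_riesz_sq {d : ℕ} {σ α : ℝ} (hσ0 : 0 < σ) (hα : σ < α) (hαd : α < d / 2)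
    (x : Lattice d) : hardyWeight d σ α x * riesz α x ^ 2 = riesz (α - σ) x * riesz α x := by
  have := (riesz_pos (hσ0.trans hα) hαd x).ne'
  rw [hardyWeight_eq hσ0 hα]
  field_simp

theorem isPositiveCritical_hardyWeight {d : ℕ} (hd : 1 ≤ d) {σ α : ℝ} (hσ0 : 0 < σ) (hσ1 : σ ≤ 1)
    (hα : σ < α) (hαd : α < d / 2) (h : 2 * α - σ < d / 2) :
    IsPositiveCritical σ (hardyWeight d σ α) := by
  have hpos : ∀ x : Lattice d, 0 < riesz α x := riesz_pos (hσ0.trans hα) hαd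
  have hE := hasEnergy_riesz (d := d) hσ0 hσ1 hα hαd h
  have hs : HasSum (fun x : Lattice d => hardyWeight d σ α x * riesz α x ^ 2)
      (riesz (2 * α - σ) (0 : Lattice d)) := by
    simp only [hardyWeight_mul_riesz_sq hσ0 hα hαd]
    have := hasSum_riesz_mul (d := d) (β := α - σ) (γ := α) (by linarith) (by linarith)
      (by linarith)
    rwa [show α - σ + α = 2 * α - σ by ring] at this
  exact ⟨(isHardyWeight_hardyWeight hd hσ0 hσ1 hα hαd).isCritical_of_minimizer hpos hE hs,
    riesz α, _, fun h0 => (hpos 0).ne' (congrFun h0 0), hE, hs⟩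

/-- Every minimizer of the Hardy inequality is a multiple of the Riesz kernel. -/
theorem minimizer_eq_smul_riesz {d : ℕ} {σ α : ℝ} (hσ0 : 0 < σ) (hσ1 : σ ≤ 1)
    (hα : σ < α) (hαd : α < d / 2) {v : Lattice d → ℝ} {E : ℝ} (hv : HasEnergy σ v E)
    (hs : HasSum (fun x => hardyWeight d σ α x * v x ^ 2) E) :
    ∃ c, ∀ x, v x = c * riesz α x := by
  have hpos : ∀ x : Lattice d, 0 < riesz α x := riesz_pos (hσ0.trans hα) hαd
  obtain ⟨φ, -, hp, hE⟩ := hv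
  have hquot : ∀ x i, v (x + Pi.single i 1) / riesz α (x + Pi.single i 1) = v x / riesz α x := by
    intro x i
    set K := -fracEntry σ (x + Pi.single i 1) x * (riesz α x * riesz α (x + Pi.single i 1)) with hK
    have hK0 : 0 < K := mul_pos (neg_pos.2 (fracEntry_neighbour_neg hσ0 hσ1 x i))
      (mul_pos (hpos _) (hpos _))
    set D := v x / riesz α x - v (x + Pi.single i 1) / riesz α (x + Pi.single i 1) with hD
    have h1 : ∀ F : Finset (Lattice d),
        ∑ y ∈ F, hardyWeight d σ α y * v y ^ 2 + K * D ^ 2 ≤ E := fun F =>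
      le_of_tendsto_of_tendsto'
        ((tendsto_finsetSum F fun y _ => ((hp y).pow 2).const_mul (hardyWeight d σ α y)).add
          (((((hp x).div_const _).sub ((hp (x + Pi.single i 1)).div_const _)).pow 2).const_mul K))
        hE fun n => hardy_with_remainder hσ0 hσ1 hα hαd (φ n) F x i
    -- The finite sums exhaust `E`, so no room is left for the remainder.
    have h2 : E + K * D ^ 2 ≤ E := le_of_tendsto' (hs.add_const (K * D ^ 2)) h1
    have h3 : D ^ 2 = 0 := le_antisymm (by nlinarith) (sq_nonneg D)
    have h4 : D = 0 := pow_eq_zero_iff two_ne_zero |>.1 h3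
    linarith
  refine ⟨v 0 / riesz α (0 : Lattice d), fun x => ?_⟩
  rw [← div_eq_iff (hpos x).ne']
  induction x using lattice_induction (y := 0) with
  | hy => rfl
  | hp x i hx => rw [hquot, hx]
  | hm x i hx => rw [← hquot (x - Pi.single i 1) i, sub_add_cancel, hx]

theorem lt_of_isPositiveCritical {d : ℕ} {σ α : ℝ} (hσ0 : 0 < σ) (hσ1 : σ ≤ 1)
    (hα : σ < α) (hαd : α < d / 2) (h : IsPositiveCritical σ (hardyWeight d σ α)) :
    2 * α - σ < d / 2 := by
  by_contra hge
  obtain ⟨-, v, E, hv0, hv, hs⟩ := h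
  obtain ⟨c, hc⟩ := minimizer_eq_smul_riesz hσ0 hσ1 hα hαd hv hs
  have hc0 : c ≠ 0 := by
    rintro rfl
    exact hv0 (funext fun x => by simp [hc x])
  -- With `v = c u` and `c ≠ 0`, finiteness of `∑ w v²` would make `κ_{σ-α} κ_{-α}` summable.
  refine not_summable_riesz_mul (d := d) (β := α - σ) (γ := α) (by linarith) (by linarith)
    (by linarith) hαd (by linarith) ?_
  refine (hs.summable.mul_left (c ^ 2)⁻¹).congr fun x => ?_
  rw [hc, ← hardyWeight_mul_riesz_sq hσ0 hα hαd]
  field_simp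

end LatticeHardy
end

theorem theorem3p2 (d : ℕ) (hd : 1 ≤ d) (σ α : ℝ) (hσ0 : 0 < σ) (hσ1 : σ ≤ 1)
    (hσd : d ≤ 2 → σ < (d : ℝ) / 2) (hα : σ < α) (hαd : α < (d : ℝ) / 2) :
    LatticeHardy.IsPositiveCritical σ (LatticeHardy.hardyWeight d σ α) ↔
      α < ((d : ℝ) / 2 + σ) / 2 := by
  constructor
  · intro h
    have := LatticeHardy.lt_of_isPositiveCritical hσ0 hσ1 hα hαd h
    linarith
  · intro h
    exact LatticeHardy.isPositiveCritical_hardyWeight hd hσ0 hσ1 hα hαd (by linarith)
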